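/- **Setting.** Let $\mathcal X,\mathcal Y,\mathcal Z$ be finite alphabets ($\mathcal X\neq\emptyset$) and let a channel with noisy feedback be given, i.e. conditional distributions $p(y_i\mid x^i,y^{i-1})$ (forward channel) and $p(z_i\mid y^i,z^{i-1})$ (feedback link), $i\ge 1$. A code-function of length $n$ is $f^n=(f_1,\dots,f_n)$ with $f_i:\mathcal Z^{i-1}\to\mathcal X$. Using $f^n$ means transmitting $x_i=f_i(z^{i-1})$, so that $$p(y^n,z^n\mid f^n)=\prod_{i=1}^n p\big(y_i\mid f_1,f_2(z_1),\dots,f_i(z^{i-1}),y^{i-1}\big)\,p(z_i\mid y^i,z^{i-1}).$$ A code of length $n$ with $M$ messages consists of code-functions $f^n[1],\dots,f^n[M]$ and a decoder $g:\mathcal Y^n\to\{1,\dots,M\}$; its error probability is $\frac1M\sum_{w=1}^M P(g(Y^n)\ne w\mid f^n[w])$. A rate $R\ge0$ is $\epsilon$-achievable if for every $\delta>0$ and all sufficiently large $n$ there is a code of length $n$ with error probability at most $\epsilon$ and $\frac{1}{n}\log M\ge R-\delta$. The capacity $C_{FB}^{noise}$ is the supremum of the rates that are $\epsilon$-achievable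 for all $0<\epsilon<1$. The channel has the *strong converse property* if for every real $R>C_{FB}^{noise}$ and every sequence of codes of length $n$ with $M_n$ messages, $\liminf_n\frac1n\log M_n\ge R$ implies that the error probabilities tend to $1$. Logarithms are to base $2$. An input process $X$ consists, for each $n$, of channel input distributions $\{p(x_i\mid x^{i-1},z^{i-1})\}_{i=1}^n$ and of a random code-function $F^n$ that is good with respect to them, i.e. $P\big(F_1=x_1,F_2(z_1)=x_2,\dots,F_n(z^{n-1})=x_n\big)=\prod_{i=1}^n p(x_i\mid x^{i-1},z^{i-1})$ for all $x^n,z^{n-1}$. (The distributions for different $n$ need not be consistent.) With $X_i=F_i(Z^{i-1})$, and all conditional probabilities taken under the joint law of $(F^n,X^n,Y^n,Z^n)$, let $$i^R(X^n(F^n)\to Y^n)=\log\frac{\prod_{i=1}^n p(Y_i\mid X^i,Y^{i-1})}{p(Y^n)}-\log\frac{\prod_{i=1}^n p(Y_i\mid X^i,F^i,Y^{i-1})}{\prod_{i=1}^n p(Y_i\mid F^i,Y^{i-1})}$$ be the residual directed information density and $I^R(X^n(F^n)\to Y^n)$ its expectation. For real random variables $V_n$, $\operatorname{p-lim\,sup}_n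 V_n=\inf\{\alpha:\lim_n P(V_n>\alpha)=0\}$ and $\operatorname{p-lim\,inf}_n V_n=\sup\{\beta:\lim_n P(V_n<\beta)=0\}$. **Theorem 5 (Strong Converse Theorem).** The channel with noisy feedback has the strong converse property if and only if $$\sup_X\ \operatorname*{p-lim\,inf}_{n\to\infty}\ \tfrac1n\, i^R(X^n(F^n)\to Y^n)\;=\;\sup_X\ \operatorname*{p-lim\,sup}_{n\to\infty}\ \tfrac1n\, i^R(X^n(F^n)\to Y^n),$$ the suprema being over all input processes. Furthermore, if the strong converse property holds, then $$C_{FB}^{noise}=\sup_X\lim_{n\to\infty}\tfrac1n\, I^R(X^n(F^n)\to Y^n),$$ the supremum being over the input processes for which the limit exists. -/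

import Mathlib

open Filter Topology

noncomputable section

namespace NoisyFeedback

/-- A code-function of horizon `n`: the maps `f_i : Z^{i-1} → X`, `1 ≤ i ≤ n`. Times are counted
from `0`, so the map at position `i : Fin n` sees the `i` earlier feedback symbols. -/
def CodeFn (X Z : Type*) (n : ℕ) : Type _ := (i : Fin n) → (Fin i → Z) → X

/-- Over finite alphabets there are finitely many code-functions. -/
instance instFintypeCodeFn {X Z : Type*} [Finite X] [Finite Z] {n : ℕ} :
    Fintype (CodeFn X Z n) :=
  @Fintype.ofFinite _ (inferInstanceAs (Finite ((i : Fin n) → (Fin i → Z) → X)))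

namespace CodeFn

variable {X Z : Type*} {n : ℕ}

/-- The first `k` maps `f^k` of a code-function `f^n`. -/
def upTo (f : CodeFn X Z n) (k : ℕ) (h : k ≤ n) : CodeFn X Z k :=
  fun j => f (Fin.castLE h j)

/-- The channel inputs `x^n = f^n(z^{n-1})` that the code-function `f` produces from the feedback
symbols `z`. -/
def encode (f : CodeFn X Z n) (z : Fin n → Z) : Fin n → X :=
  fun i => f i (Fin.take i i.2.le z)

end CodeFn

/-- A channel with noisy feedback: the forward channel `p(y_i | x^i, y^{i-1})` and the feedback
link `p(z_i | y^i, z^{i-1})`, for all times `i` (counted from `0`). -/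
structure Channel (X Y Z : Type*) where
  /-- the forward channel -/
  forward : (i : ℕ) → (Fin (i + 1) → X) → (Fin i → Y) → PMF Y
  /-- the feedback link -/
  feedback : (i : ℕ) → (Fin (i + 1) → Y) → (Fin i → Z) → PMF Z

/-- Probability of an event, as a real number. -/
def pr {Ω : Type*} (P : PMF Ω) (s : Set Ω) : ℝ := (P.toOuterMeasure s).toReal

/-- Expectation of a real random variable on a finite probability space. -/
def expect {Ω : Type*} [Fintype Ω] (P : PMF Ω) (V : Ω → ℝ) : ℝ := ∑ ω, (P ω).toReal * V ω

/-- The conditional probability `p(U | V)`, as a random variable: its value at `ω` is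
`P(U = U(ω), V = V(ω)) / P(V = V(ω))`. -/
def condPr {Ω A B : Type*} (P : PMF Ω) (U : Ω → A) (V : Ω → B) (ω : Ω) : ℝ :=
  pr P {ω' | U ω' = U ω ∧ V ω' = V ω} / pr P {ω' | V ω' = V ω}

/-- Limit superior in probability of a sequence of real random variables (the `n`-th one lives on
its own probability space). -/
def pLimsup {Ω : ℕ → Type*} (P : (n : ℕ) → PMF (Ω n)) (V : (n : ℕ) → Ω n → ℝ) : EReal :=
  ⨅ (α : ℝ) (_ : Tendsto (fun n => pr (P n) {ω | V n ω > α}) atTop (𝓝 0)), (α : EReal)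

/-- Limit inferior in probability of a sequence of real random variables. -/
def pLiminf {Ω : ℕ → Type*} (P : (n : ℕ) → PMF (Ω n)) (V : (n : ℕ) → Ω n → ℝ) : EReal :=
  ⨆ (β : ℝ) (_ : Tendsto (fun n => pr (P n) {ω | V n ω < β}) atTop (𝓝 0)), (β : EReal)

/-- The sample space of a transmission of length `n`: code-function, channel outputs, feedback
symbols. -/
abbrev Sample (X Y Z : Type*) (n : ℕ) : Type _ := CodeFn X Z n × (Fin n → Y) × (Fin n → Z)

namespace Sample

variable {X Y Z : Type*} {n : ℕ}

/-- The code-function `F^n`. -/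
def F (ω : Sample X Y Z n) : CodeFn X Z n := ω.1

/-- The channel outputs `Y^n`. -/
def Ys (ω : Sample X Y Z n) : Fin n → Y := ω.2.1

/-- The channel inputs `X^n = F^n(Z^{n-1})`. -/
def Xs (ω : Sample X Y Z n) : Fin n → X := ω.1.encode ω.2.2

end Sample

section Information

variable {X Y Z : Type*} {n : ℕ}

/-- Causal conditional probability `∏ p(Y_i | X^i, Y^{i-1})`, as a random variable. -/
def causalX (P : PMF (Sample X Y Z n)) (ω : Sample X Y Z n) : ℝ :=
  ∏ i : Fin n, condPr P (fun ω' => ω'.Ys i)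
    (fun ω' => (Fin.take (i + 1) i.2 ω'.Xs, Fin.take i i.2.le ω'.Ys)) ω

/-- Causal conditional probability `∏ p(Y_i | F^i, Y^{i-1})`, as a random variable. -/
def causalF (P : PMF (Sample X Y Z n)) (ω : Sample X Y Z n) : ℝ :=
  ∏ i : Fin n, condPr P (fun ω' => ω'.Ys i)
    (fun ω' => (ω'.F.upTo (i + 1) i.2, Fin.take i i.2.le ω'.Ys)) ω

/-- Causal conditional probability `∏ p(Y_i | X^i, F^i, Y^{i-1})`, as a random variable. -/
def causalXF (P : PMF (Sample X Y Z n)) (ω : Sample X Y Z n) : ℝ :=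
  ∏ i : Fin n, condPr P (fun ω' => ω'.Ys i)
    (fun ω' => (Fin.take (i + 1) i.2 ω'.Xs, ω'.F.upTo (i + 1) i.2, Fin.take i i.2.le ω'.Ys)) ω

/-- Directed information density `i(X^n → Y^n)`, in bits. -/
def dirDensity (P : PMF (Sample X Y Z n)) (ω : Sample X Y Z n) : ℝ :=
  Real.logb 2 (causalX P ω / pr P {ω' | ω'.Ys = ω.Ys})

/-- Causal conditional directed information density `i(X^n → Y^n || F^n)`, in bits. -/
def condDirDensity (P : PMF (Sample X Y Z n)) (ω : Sample X Y Z n) : ℝ :=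
  Real.logb 2 (causalXF P ω / causalF P ω)

/-- Residual directed information density
`i^R(X^n(F^n) → Y^n) = i(X^n → Y^n) - i(X^n → Y^n || F^n)`. -/
def resDensity (P : PMF (Sample X Y Z n)) (ω : Sample X Y Z n) : ℝ :=
  dirDensity P ω - condDirDensity P ω

/-- Residual directed information
`I^R(X^n(F^n) → Y^n) = I(X^n → Y^n) - I(X^n → Y^n || F^n)`. -/
def resInfo [Fintype X] [Fintype Y] [Fintype Z] (P : PMF (Sample X Y Z n)) : ℝ :=
  expect P (dirDensity P) - expect P (condDirDensity P)

end Information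

section Inputs

variable (X Z : Type*)

/-- Channel input distributions `p(x_i | x^{i-1}, z^{i-1})`, `1 ≤ i ≤ n`, one family for each
horizon `n`; no consistency between different horizons is required. -/
abbrev InputLaw : Type _ :=
  (n : ℕ) → (i : Fin n) → (Fin i → X) → (Fin i → Z) → PMF X

/-- Code-function distributions `p(f^n)`, one for each horizon `n`. -/
abbrev CodeFnLaw : Type _ := (n : ℕ) → PMF (CodeFn X Z n)

variable {X Z}

/-- The code-function distributions `p` are good with respect to the channel input distributions
`q`: for all `x^n` and `z^{n-1}`, the probability that `F^n(z^{n-1}) = x^n` is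
`∏ q(x_i | x^{i-1}, z^{i-1})`. -/
def GoodFor (p : CodeFnLaw X Z) (q : InputLaw X Z) : Prop :=
  ∀ (n : ℕ) (x : Fin n → X) (z : Fin n → Z),
    (p n).toOuterMeasure {f | f.encode z = x} =
      ∏ i : Fin n, q n i (Fin.take i i.2.le x) (Fin.take i i.2.le z) (x i)

end Inputs

/-- A channel code of length `n` with `M` messages: a code-function for every message, and a
decoder. -/
structure Code (X Y Z : Type*) (n M : ℕ) where
  /-- the encoder -/
  enc : Fin M → CodeFn X Z n
  /-- the decoder -/
  dec : (Fin n → Y) → Fin M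

namespace Channel

variable {X Y Z : Type*} [Fintype Y] [Fintype Z]

/-- `p(y^n, z^n | f^n) = ∏ p(y_i | f^i(z^{i-1}), y^{i-1}) p(z_i | y^i, z^{i-1})`. -/
def outMass (ch : Channel X Y Z) {n : ℕ} (f : CodeFn X Z n)
    (yz : (Fin n → Y) × (Fin n → Z)) : ENNReal :=
  ∏ i : Fin n,
    ch.forward i (Fin.take (i + 1) i.2 (f.encode yz.2)) (Fin.take i i.2.le yz.1) (yz.1 i) *
    ch.feedback i (Fin.take (i + 1) i.2 yz.1) (Fin.take i i.2.le yz.2) (yz.2 i)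

theorem take_snoc {A : Type*} {n : ℕ} (a : Fin n → A) (b : A) (k : ℕ) (hk : k ≤ n)
    (hk' : k ≤ n + 1) : Fin.take k hk' (Fin.snoc a b : Fin (n + 1) → A) = Fin.take k hk a := by
  funext j
  exact Fin.snoc_castSucc (α := fun _ => A) b a (Fin.castLE hk j)

theorem sum_coe {A : Type*} [Fintype A] (p : PMF A) : ∑ a, p a = 1 := by
  simpa [tsum_fintype] using p.tsum_coe

theorem sum_outMass (ch : Channel X Y Z) : ∀ {n : ℕ} (f : CodeFn X Z n),
    ∑ yz, ch.outMass f yz = 1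
  | 0, f => by simp [outMass]
  | n + 1, f => by
    let e : ((Fin n → Y) × (Fin n → Z)) × (Y × Z) ≃ (Fin (n + 1) → Y) × (Fin (n + 1) → Z) :=
      (Equiv.prodProdProdComm _ _ _ _).trans (Equiv.prodCongr
        ((Equiv.prodComm _ _).trans (Fin.snocEquiv fun _ => Y))
        ((Equiv.prodComm _ _).trans (Fin.snocEquiv fun _ => Z)))
    rw [← e.sum_comp, Fintype.sum_prod_type, ← sum_outMass ch (f.upTo n n.le_succ)]
    refine Finset.sum_congr rfl fun yz _ => ?_
    have henc : ∀ z b, f.encode (Fin.snoc z b : Fin (n + 1) → Z) =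
        (Fin.snoc ((f.upTo n n.le_succ).encode z) (f (Fin.last n) z) : Fin (n + 1) → X) := by
      intro z b
      funext i
      refine Fin.lastCases ?_ (fun j => ?_) i
      · rw [Fin.snoc_last]
        exact congrArg (f (Fin.last n)) (take_snoc z b n le_rfl n.le_succ)
      · rw [Fin.snoc_castSucc]
        exact congrArg (f j.castSucc) (take_snoc z b j j.2.le _)
    have key : ∀ ab : Y × Z, ch.outMass f (e (yz, ab)) =
        ch.outMass (f.upTo n n.le_succ) yz *
          (ch.forward n (Fin.snoc ((f.upTo n n.le_succ).encode yz.2) (f (Fin.last n) yz.2))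
              yz.1 ab.1 *
            ch.feedback n (Fin.snoc yz.1 ab.1) yz.2 ab.2) := by
      intro ab
      have he : e (yz, ab) = (Fin.snoc yz.1 ab.1, Fin.snoc yz.2 ab.2) := rfl
      rw [he, outMass, Fin.prod_univ_castSucc]
      dsimp only
      rw [henc]
      simp only [Fin.snoc_castSucc, Fin.snoc_last, Fin.val_castSucc, Fin.val_last]
      congr 1
      · refine Finset.prod_congr rfl fun i _ => ?_
        rw [take_snoc _ _ (i + 1) i.2, take_snoc yz.1 ab.1 i i.2.le, take_snoc _ _ (i + 1) i.2,
          take_snoc yz.2 ab.2 i i.2.le]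
      · rw [take_snoc yz.1 ab.1 n le_rfl, take_snoc yz.2 ab.2 n le_rfl]
        rfl
    simp only [key]
    rw [← Finset.mul_sum, Fintype.sum_prod_type]
    have h2 : ∀ (p : PMF Y) (q : Y → PMF Z), ∑ a, ∑ b, p a * q a b = 1 := by
      intro p q
      simp only [← Finset.mul_sum, sum_coe, mul_one]
    rw [h2 (ch.forward n _ yz.1) fun a => ch.feedback n (Fin.snoc yz.1 a) yz.2, mul_one]

/-- The law of channel outputs and feedback symbols when the code-function `f` is used. -/
def outLaw (ch : Channel X Y Z) {n : ℕ} (f : CodeFn X Z n) :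
    PMF ((Fin n → Y) × (Fin n → Z)) :=
  PMF.ofFintype (ch.outMass f) (ch.sum_outMass f)

/-- The joint law of code-function, channel outputs and feedback symbols, when the code-function
has law `p`. -/
def jointLaw (ch : Channel X Y Z) {n : ℕ} (p : PMF (CodeFn X Z n)) : PMF (Sample X Y Z n) :=
  p.bind fun f => (ch.outLaw f).map fun yz => (f, yz)

/-- Average probability of decoding error of a code. -/
def errorProb (ch : Channel X Y Z) {n M : ℕ} (c : Code X Y Z n M) : ℝ :=
  (∑ w : Fin M, pr (ch.outLaw (c.enc w)) {yz | c.dec yz.1 ≠ w}) / M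

/-- `R` is an `ε`-achievable rate: for every `δ > 0` there is, for all large `n`, a code of length
`n`, error probability at most `ε` and rate at least `R - δ`. -/
def IsAchievable (ch : Channel X Y Z) (ε R : ℝ) : Prop :=
  0 ≤ R ∧ ∀ δ : ℝ, 0 < δ → ∀ᶠ n : ℕ in atTop, ∃ (M : ℕ) (c : Code X Y Z n M),
    ch.errorProb c ≤ ε ∧ R - δ ≤ Real.logb 2 M / n

/-- The capacity: the supremum of the rates that are `ε`-achievable for all `0 < ε < 1`. -/
def capacity (ch : Channel X Y Z) : EReal :=
  ⨆ (R : ℝ) (_ : ∀ ε : ℝ, 0 < ε → ε < 1 → ch.IsAchievable ε R), (R : EReal)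

/-- The strong converse property: above capacity, the error probabilities of every sequence of
codes tend to `1`. -/
def HasStrongConverse (ch : Channel X Y Z) : Prop :=
  ∀ R : ℝ, ch.capacity < R → ∀ (M : ℕ → ℕ) (c : (n : ℕ) → Code X Y Z n (M n)),
    (R : EReal) ≤ liminf (fun n : ℕ => ((Real.logb 2 (M n) / n : ℝ) : EReal)) atTop →
    Tendsto (fun n => ch.errorProb (c n)) atTop (𝓝 1)

/-- `p-liminf (1/n) i^R(X^n(F^n) → Y^n)`, when `F^n` has law `p n`. -/
def infRate (ch : Channel X Y Z) (p : CodeFnLaw X Z) : EReal :=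
  pLiminf (fun n => ch.jointLaw (p n)) fun n ω => resDensity (ch.jointLaw (p n)) ω / n

/-- `p-limsup (1/n) i^R(X^n(F^n) → Y^n)`, when `F^n` has law `p n`. -/
def supRate (ch : Channel X Y Z) (p : CodeFnLaw X Z) : EReal :=
  pLimsup (fun n => ch.jointLaw (p n)) fun n ω => resDensity (ch.jointLaw (p n)) ω / n

end Channel

end NoisyFeedback

end

/-! A code-function is a single input letter of an ordinary channel with transition law p(y^n |
f^n), where feedback is absorbed into the letter. Given past inputs and outputs, the forward channel
ignores the code-function, so the causal products over X and over (X, F) agree wherever the joint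
law is positive and cancel (`causalX_eq`, `causalXF_eq`). The product over F telescopes to p(y^n |
f^n) (`causalF_eq`). Hence i^R is the information density log p(y^n | f^n) / p(y^n)
(`resDensity_eq`), and the theorem becomes the Verdú–Han strong converse for a general channel. The
input distributions impose no constraint: every code-function law is good for some of them
(`exists_goodFor`), so the suprema run over all code-function laws.

Two one-shot bounds carry the coding part. Feinstein's lemma (`exists_code_errorProb_le`) turns a
law into a code whose error is about the probability that the density lies below log M; the
Verdú–Han lemma (`exists_law_pr_resDensity_le`) reverses this with the uniform law on the codewords.
They show that capacity is the largest inf-rate, attained by a diagonal law, and that the strong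
converse holds exactly when no sup-rate exceeds capacity. As inf-rates never exceed sup-rates, the
latter condition is equality of the suprema.

For expectations, the lower tail of the density costs O(1) bits and the upper tail at most its
probability times n log |Y| plus O(1). After division by n, the mean is therefore squeezed between
inf-rate and sup-rate. -/

noncomputable section

namespace NoisyFeedback

/-! ### Causality of the output law for a fixed code-function -/

section Marginals

variable {X Y Z : Type*} {n : ℕ}

theorem CodeFn.encode_snoc (f : CodeFn X Z (n + 1)) (z : Fin n → Z) (b : Z) :
    f.encode (Fin.snoc z b : Fin (n + 1) → Z) =
      (Fin.snoc ((f.upTo n n.le_succ).encode z) (f (Fin.last n) z) : Fin (n + 1) → X) := by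
  funext i
  refine Fin.lastCases ?_ (fun j => ?_) i
  · rw [Fin.snoc_last]
    exact congrArg (f (Fin.last n)) (Channel.take_snoc z b n le_rfl n.le_succ)
  · rw [Fin.snoc_castSucc]
    exact congrArg (f j.castSucc) (Channel.take_snoc z b j j.2.le _)

namespace Channel

variable (ch : Channel X Y Z)

theorem outMass_snoc (f : CodeFn X Z (n + 1)) (y : Fin n → Y) (z : Fin n → Z) (a : Y) (b : Z) :
    ch.outMass f (Fin.snoc y a, Fin.snoc z b) =
      ch.outMass (f.upTo n n.le_succ) (y, z) *
        (ch.forward n (Fin.snoc ((f.upTo n n.le_succ).encode z) (f (Fin.last n) z)) y a *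
          ch.feedback n (Fin.snoc y a) z b) := by
  rw [outMass, Fin.prod_univ_castSucc]
  dsimp only
  rw [CodeFn.encode_snoc]
  simp only [Fin.snoc_castSucc, Fin.snoc_last, Fin.val_castSucc, Fin.val_last]
  congr 1
  · refine Finset.prod_congr rfl fun i _ => ?_
    rw [take_snoc _ _ (i + 1) i.2, take_snoc y a i i.2.le, take_snoc _ _ (i + 1) i.2,
      take_snoc z b i i.2.le]
  · rw [take_snoc y a n le_rfl, take_snoc z b n le_rfl]
    rfl

theorem sum_toReal {A : Type*} [Fintype A] (p : PMF A) : ∑ a, (p a).toReal = 1 := by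
  rw [← ENNReal.toReal_sum fun a _ => p.apply_ne_top a, sum_coe, ENNReal.toReal_one]

variable [Fintype Z]

/-- Probability `p(y^n | f^n)` of the channel outputs when the code-function `f` is used. -/
def outProb (f : CodeFn X Z n) (y : Fin n → Y) : ℝ := ∑ z, (ch.outMass f (y, z)).toReal

theorem outProb_nonneg (f : CodeFn X Z n) (y : Fin n → Y) : 0 ≤ ch.outProb f y :=
  Finset.sum_nonneg fun _ _ => ENNReal.toReal_nonneg

variable [Fintype Y]

/-- Summation over the last output and the last feedback symbol. -/
theorem sum_outMass_succ (f : CodeFn X Z (n + 1))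
    (g : (Fin (n + 1) → Y) × (Fin (n + 1) → Z) → ℝ) :
    ∑ yz, (ch.outMass f yz).toReal * g yz =
      ∑ s : (Fin n → Y) × (Fin n → Z), (ch.outMass (f.upTo n n.le_succ) s).toReal *
        ∑ a, (ch.forward n (Fin.snoc ((f.upTo n n.le_succ).encode s.2) (f (Fin.last n) s.2))
            s.1 a).toReal *
          ∑ b, (ch.feedback n (Fin.snoc s.1 a) s.2 b).toReal * g (Fin.snoc s.1 a, Fin.snoc s.2 b) := by
  let e : ((Fin n → Y) × (Fin n → Z)) × (Y × Z) ≃ (Fin (n + 1) → Y) × (Fin (n + 1) → Z) :=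
    (Equiv.prodProdProdComm _ _ _ _).trans (Equiv.prodCongr
      ((Equiv.prodComm _ _).trans (Fin.snocEquiv fun _ => Y))
      ((Equiv.prodComm _ _).trans (Fin.snocEquiv fun _ => Z)))
  rw [← e.sum_comp, Fintype.sum_prod_type]
  refine Finset.sum_congr rfl fun s _ => ?_
  rw [Fintype.sum_prod_type, Finset.mul_sum]
  refine Finset.sum_congr rfl fun a _ => ?_
  rw [Finset.mul_sum, Finset.mul_sum]
  refine Finset.sum_congr rfl fun b _ => ?_
  have he : e (s, (a, b)) = (Fin.snoc s.1 a, Fin.snoc s.2 b) := rfl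
  rw [he, outMass_snoc, ENNReal.toReal_mul, ENNReal.toReal_mul]
  ring

/-- The first `k` outputs and feedback symbols are governed by the first `k` maps of the
code-function. -/
theorem sum_outMass_take {k : ℕ} (hk : k ≤ n) (f : CodeFn X Z n)
    (g : (Fin k → Y) × (Fin k → Z) → ℝ) :
    ∑ yz : (Fin n → Y) × (Fin n → Z),
        (ch.outMass f yz).toReal * g (Fin.take k hk yz.1, Fin.take k hk yz.2) =
      ∑ s, (ch.outMass (f.upTo k hk) s).toReal * g s := by
  induction n, hk using Nat.le_induction with
  | base => rfl
  | succ n hk ih =>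
    rw [sum_outMass_succ]
    simp only [take_snoc _ _ k hk, ← Finset.sum_mul, sum_toReal, one_mul]
    exact ih (f.upTo n n.le_succ)

open scoped Classical in
/-- Conditionally on the first `k` outputs and feedback symbols, the next output is governed by
the forward channel. -/
theorem sum_outMass_forward (f : CodeFn X Z n) (k : Fin n) (b : Y)
    (h : (Fin n → Y) × (Fin n → Z) → ℝ)
    (hh : h.FactorsThrough fun yz => (Fin.take k k.2.le yz.1, Fin.take k k.2.le yz.2)) :
    ∑ yz with yz.1 k = b, (ch.outMass f yz).toReal * h yz =
      ∑ yz, (ch.outMass f yz).toReal *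
        ((ch.forward k (Fin.take (k + 1) k.2 (f.encode yz.2)) (Fin.take k k.2.le yz.1) b).toReal *
          h yz) := by
  obtain ⟨g, rfl⟩ := (Function.factorsThrough_iff h).1 hh
  -- Both sides reduce to one sum over histories of length `k`: the left by cutting at `k + 1` and
  -- summing out the last step, the right by cutting at `k`.
  have h1 := ch.sum_outMass_take (k := k + 1) k.2 f
    (fun s => (if s.1 (Fin.last k) = b then 1 else 0) *
      g (Fin.take k (Nat.le_succ _) s.1, Fin.take k (Nat.le_succ _) s.2))
  have h2 := ch.sum_outMass_take (k := k) k.2.le f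
    (fun s => (ch.forward k (Fin.snoc ((f.upTo k k.2.le).encode s.2) (f k s.2)) s.1 b).toReal * g s)
  rw [sum_outMass_succ] at h1
  simp only [take_snoc _ _ _ le_rfl, Fin.snoc_last, ← Finset.sum_mul, sum_toReal, one_mul] at h1
  simp only [ite_mul, one_mul, zero_mul, mul_ite, mul_zero, Finset.sum_ite_eq', Finset.mem_univ,
    if_true] at h1
  -- The first `k + 1` inputs need only `k` feedback symbols.
  have h3 : ∀ z : Fin n → Z, Fin.take (k + 1) k.2 (f.encode z) =
      Fin.snoc ((f.upTo k k.2.le).encode (Fin.take k k.2.le z)) (f k (Fin.take k k.2.le z)) := by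
    intro z
    funext i
    refine Fin.lastCases ?_ (fun j => ?_) i
    · rw [Fin.snoc_last]; rfl
    · rw [Fin.snoc_castSucc]; rfl
  rw [Finset.sum_filter]
  simp only [h3]
  exact h1.trans h2.symm

theorem sum_outMass_toReal (f : CodeFn X Z n) : ∑ yz, (ch.outMass f yz).toReal = 1 :=
  sum_toReal (ch.outLaw f)

theorem sum_outProb (f : CodeFn X Z n) : ∑ y, ch.outProb f y = 1 := by
  rw [← ch.sum_outMass_toReal f, Fintype.sum_prod_type]
  rfl

-- Later maps cannot influence earlier outputs. This is what lets the product defining `causalF`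
-- telescope.
open scoped Classical in
theorem sum_outMass_take_eq {k : ℕ} (hk : k ≤ n) (f : CodeFn X Z n) (y : Fin k → Y) :
    ∑ yz : (Fin n → Y) × (Fin n → Z) with Fin.take k hk yz.1 = y, (ch.outMass f yz).toReal =
      ch.outProb (f.upTo k hk) y := by
  have := ch.sum_outMass_take hk f (fun s => if s.1 = y then 1 else 0)
  simp only [mul_ite, mul_one, mul_zero] at this
  rw [Finset.sum_filter]
  refine this.trans ?_
  rw [Fintype.sum_prod_type, Finset.sum_eq_single y]
  · simp [outProb]
  · intro b _ hb
    simp [hb]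
  · simp

end Channel

end Marginals

/-! ### Probabilities as finite sums -/

theorem sum_filter_congr {ι : Type*} [Fintype ι] {P Q : ι → Prop} {_ : DecidablePred P}
    {_ : DecidablePred Q} (g : ι → ℝ) (h : ∀ x, P x ↔ Q x) :
    ∑ x with P x, g x = ∑ x with Q x, g x :=
  Finset.sum_congr (by ext; simp [h]) fun _ _ => rfl

open scoped Classical in
theorem pr_eq_sum {Ω : Type*} [Fintype Ω] (P : PMF Ω) (s : Set Ω) :
    pr P s = ∑ ω with ω ∈ s, (P ω).toReal := by
  rw [pr, PMF.toOuterMeasure_apply_fintype, Finset.sum_filter,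
    ENNReal.toReal_sum fun ω _ => ?_]
  · refine Finset.sum_congr rfl fun ω _ => ?_
    by_cases h : ω ∈ s <;> simp [h]
  · by_cases h : ω ∈ s <;> simp [h, P.apply_ne_top]

theorem pr_nonneg {Ω : Type*} (P : PMF Ω) (s : Set Ω) : 0 ≤ pr P s := ENNReal.toReal_nonneg

theorem pr_pos {Ω : Type*} [Fintype Ω] (P : PMF Ω) (s : Set Ω) (ω : Ω) (hω : ω ∈ s)
    (h : P ω ≠ 0) : 0 < pr P s := by
  classical
  rw [pr_eq_sum]
  exact Finset.sum_pos' (fun _ _ => ENNReal.toReal_nonneg)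
    ⟨ω, by simpa using hω, ENNReal.toReal_pos h (P.apply_ne_top ω)⟩

/-! ### The residual density as an information density -/

section Joint

variable {X Y Z : Type*} [Fintype Y] [Fintype Z] {n : ℕ}

namespace Channel

variable (ch : Channel X Y Z) (p : PMF (CodeFn X Z n))

theorem outProb_pos (f : CodeFn X Z n) (yz : (Fin n → Y) × (Fin n → Z))
    (h : ch.outMass f yz ≠ 0) : 0 < ch.outProb f yz.1 :=
  Finset.sum_pos' (fun _ _ => ENNReal.toReal_nonneg)
    ⟨yz.2, Finset.mem_univ _, ENNReal.toReal_pos h ((ch.outLaw f).apply_ne_top yz)⟩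

theorem jointLaw_apply (f : CodeFn X Z n) (yz : (Fin n → Y) × (Fin n → Z)) :
    ch.jointLaw p (f, yz) = p f * ch.outMass f yz := by
  classical
  rw [jointLaw, PMF.bind_apply, tsum_eq_single f]
  · rw [PMF.map_apply, tsum_eq_single yz]
    · simp [outLaw]
    · intro yz' h
      exact if_neg fun h' => h (congrArg Prod.snd h').symm
  · intro f' h
    rw [PMF.map_apply, ENNReal.tsum_eq_zero.2, mul_zero]
    intro yz'
    rw [if_neg]
    intro h'
    exact h (congrArg Prod.fst h').symm

variable [Finite X]

open scoped Classical in
theorem sum_jointLaw (g : Sample X Y Z n → ℝ) :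
    ∑ ω, (ch.jointLaw p ω).toReal * g ω =
      ∑ f, (p f).toReal * ∑ yz, (ch.outMass f yz).toReal * g (f, yz) := by
  rw [Fintype.sum_prod_type]
  refine Finset.sum_congr rfl fun f _ => ?_
  rw [Finset.mul_sum]
  refine Finset.sum_congr rfl fun yz _ => ?_
  rw [jointLaw_apply, ENNReal.toReal_mul, mul_assoc]

open scoped Classical in
theorem pr_jointLaw (S : Set (Sample X Y Z n)) :
    pr (ch.jointLaw p) S =
      ∑ f, (p f).toReal * ∑ yz with (f, yz) ∈ S, (ch.outMass f yz).toReal := by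
  have := ch.sum_jointLaw p (fun ω => if ω ∈ S then 1 else 0)
  simpa only [mul_ite, mul_one, mul_zero, ← Finset.sum_filter, ← pr_eq_sum] using this

/-- Given any random variable that is determined by the code-function and the first `k` outputs
and feedback symbols, and that determines the first `k + 1` inputs and the first `k` outputs, the
next output is governed by the forward channel. -/
theorem condPr_eq_forward {B : Type*} (V : Sample X Y Z n → B) (k : Fin n) (ω : Sample X Y Z n)
    (hω : ch.jointLaw p ω ≠ 0)
    (hV : ∀ f, Function.FactorsThrough (fun yz => V (f, yz))
      (fun yz => (Fin.take k k.2.le yz.1, Fin.take k k.2.le yz.2)))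
    (hV' : ∀ ω', V ω' = V ω → Fin.take (k + 1) k.2 ω'.Xs = Fin.take (k + 1) k.2 ω.Xs ∧
      Fin.take k k.2.le ω'.Ys = Fin.take k k.2.le ω.Ys) :
    condPr (ch.jointLaw p) (fun ω' => ω'.Ys k) V ω =
      (ch.forward k (Fin.take (k + 1) k.2 ω.Xs) (Fin.take k k.2.le ω.Ys) (ω.Ys k)).toReal := by
  classical
  have hpos : 0 < pr (ch.jointLaw p) {ω' | V ω' = V ω} := pr_pos _ _ ω rfl hω
  rw [condPr, div_eq_iff hpos.ne', pr_jointLaw, pr_jointLaw, Finset.mul_sum]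
  refine Finset.sum_congr rfl fun f _ => ?_
  have h := ch.sum_outMass_forward f k (ω.Ys k) (fun yz => if V (f, yz) = V ω then 1 else 0)
    (fun yz yz' hyz => by simp only [hV f hyz])
  simp only [mul_ite, mul_one, mul_zero, ← Finset.sum_filter, Finset.filter_filter] at h
  rw [mul_left_comm]
  congr 1
  refine (sum_filter_congr _ fun _ => Iff.rfl).trans (h.trans ?_)
  rw [Finset.mul_sum]
  -- On the event `V = V ω` the forward kernel is constant by `hV'`, so it leaves the sum as a
  -- common factor.
  refine Finset.sum_congr (by ext; simp) fun yz hyz => ?_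
  obtain ⟨h1, h2⟩ := hV' (f, yz) (Finset.mem_filter.1 hyz).2
  rw [mul_comm, ← h1, ← h2]
  rfl

theorem causalX_eq (ω : Sample X Y Z n) (hω : ch.jointLaw p ω ≠ 0) :
    causalX (ch.jointLaw p) ω = ∏ k : Fin n,
      (ch.forward k (Fin.take (k + 1) k.2 ω.Xs) (Fin.take k k.2.le ω.Ys) (ω.Ys k)).toReal := by
  refine Finset.prod_congr rfl fun k _ => ch.condPr_eq_forward p _ k ω hω (fun f yz yz' h => ?_)
    fun ω' h => Prod.ext_iff.1 h
  obtain ⟨h1, h2⟩ := Prod.ext_iff.1 h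
  refine Prod.ext (funext fun j => ?_) h1
  have hj : Fin.take j (Nat.lt_succ_iff.1 j.2) (Fin.take k k.2.le yz.2) =
      Fin.take j (Nat.lt_succ_iff.1 j.2) (Fin.take k k.2.le yz'.2) := congrArg _ h2
  exact congrArg (f (Fin.castLE k.2 j)) hj

/-- Conditioning on the code-function as well adds nothing: the value is that of `causalX_eq`, which
makes the two products cancel in the residual density. -/
theorem causalXF_eq (ω : Sample X Y Z n) (hω : ch.jointLaw p ω ≠ 0) :
    causalXF (ch.jointLaw p) ω = ∏ k : Fin n,
      (ch.forward k (Fin.take (k + 1) k.2 ω.Xs) (Fin.take k k.2.le ω.Ys) (ω.Ys k)).toReal := by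
  refine Finset.prod_congr rfl fun k _ => ch.condPr_eq_forward p _ k ω hω (fun f yz yz' h => ?_)
    fun ω' h => ⟨(Prod.ext_iff.1 h).1, (Prod.ext_iff.1 (Prod.ext_iff.1 h).2).2⟩
  obtain ⟨h1, h2⟩ := Prod.ext_iff.1 h
  refine Prod.ext (funext fun j => ?_) (Prod.ext rfl h1)
  have hj : Fin.take j (Nat.lt_succ_iff.1 j.2) (Fin.take k k.2.le yz.2) =
      Fin.take j (Nat.lt_succ_iff.1 j.2) (Fin.take k k.2.le yz'.2) := congrArg _ h2
  exact congrArg (f (Fin.castLE k.2 j)) hj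

theorem causalX_pos (ω : Sample X Y Z n) (hω : ch.jointLaw p ω ≠ 0) :
    0 < causalX (ch.jointLaw p) ω := by
  rw [causalX_eq _ _ _ hω]
  refine Finset.prod_pos fun k _ => ENNReal.toReal_pos (fun h => hω ?_) (PMF.apply_ne_top _ _)
  obtain ⟨f, yz⟩ := ω
  rw [jointLaw_apply, outMass, Finset.prod_eq_zero (Finset.mem_univ k), mul_zero]
  exact mul_eq_zero_of_left h _

/-- The first `k` outputs depend on the first `k` maps alone, so fixing further maps costs only
their prior probability. With `m = k + 1` that prior is common to numerator and denominator of p(y |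
f, past y). -/
theorem pr_upTo_take {k m : ℕ} (hk : k ≤ m) (hm : m ≤ n) (f : CodeFn X Z n) (y : Fin k → Y) :
    pr (ch.jointLaw p) {ω | ω.F.upTo m hm = f.upTo m hm ∧ Fin.take k (hk.trans hm) ω.Ys = y} =
      pr p {f' | f'.upTo m hm = f.upTo m hm} * ch.outProb (f.upTo k (hk.trans hm)) y := by
  classical
  rw [pr_jointLaw, pr_eq_sum, Finset.sum_filter, Finset.sum_mul]
  refine Finset.sum_congr rfl fun f' _ => ?_
  by_cases h : f'.upTo m hm = f.upTo m hm
  · have h' : f.upTo k (hk.trans hm) = f'.upTo k (hk.trans hm) :=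
      (congrArg (fun g => CodeFn.upTo g k hk) h).symm
    rw [if_pos (by simpa using h), h', ← sum_outMass_take_eq]
    congr 1
    exact sum_filter_congr _ fun _ => ⟨fun hyz => hyz.2, fun hyz => ⟨h, hyz⟩⟩
  · rw [if_neg (by simpa using h), zero_mul,
      sum_filter_congr (Q := fun _ => False) _ fun _ => ⟨fun hyz => h hyz.1, False.elim⟩]
    · simp
    · infer_instance

theorem causalF_eq (ω : Sample X Y Z n) (hω : ch.jointLaw p ω ≠ 0) :
    causalF (ch.jointLaw p) ω = ch.outProb ω.F ω.Ys := by
  classical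
  -- `a k` is p(y^k | f^k), and each conditional probability is `a (k + 1) / a k`. The value `1`
  -- beyond `n` is never used.
  let a : ℕ → ℝ := fun k =>
    if h : k ≤ n then ch.outProb (ω.F.upTo k h) (Fin.take k h ω.Ys) else 1
  have ha : ∀ k (h : k ≤ n), a k = ch.outProb (ω.F.upTo k h) (Fin.take k h ω.Ys) :=
    fun k h => dif_pos h
  have hstep : ∀ k : Fin n, condPr (ch.jointLaw p) (fun ω' => ω'.Ys k)
      (fun ω' => (ω'.F.upTo (k + 1) k.2, Fin.take k k.2.le ω'.Ys)) ω = a (k + 1) / a k := by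
    intro k
    have hden := ch.pr_upTo_take p (Nat.le_succ k) k.2 ω.F (Fin.take k k.2.le ω.Ys)
    have hnum := ch.pr_upTo_take p le_rfl k.2 ω.F (Fin.take (k + 1) k.2 ω.Ys)
    have hset : {ω' : Sample X Y Z n | ω'.Ys k = ω.Ys k ∧
        (ω'.F.upTo (k + 1) k.2, Fin.take k k.2.le ω'.Ys) =
          (ω.F.upTo (k + 1) k.2, Fin.take k k.2.le ω.Ys)} =
        {ω' | ω'.F.upTo (k + 1) k.2 = ω.F.upTo (k + 1) k.2 ∧
          Fin.take (k + 1) k.2 ω'.Ys = Fin.take (k + 1) k.2 ω.Ys} := by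
      ext ω'
      simp only [Set.mem_ofPred_eq, Prod.mk.injEq]
      constructor
      · rintro ⟨h1, h2, h3⟩
        refine ⟨h2, funext fun j => ?_⟩
        refine Fin.lastCases h1 (fun j => ?_) j
        exact congrFun h3 j
      · rintro ⟨h1, h2⟩
        exact ⟨congrFun h2 (Fin.last k), h1, funext fun j => congrFun h2 j.castSucc⟩
    have hp : 0 < pr p {f' | f'.upTo (k + 1) k.2 = ω.F.upTo (k + 1) k.2} := by
      refine pr_pos _ _ ω.F rfl fun h => hω ?_
      obtain ⟨f, yz⟩ := ω
      rw [jointLaw_apply, show p f = 0 from h, zero_mul]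
    rw [condPr, hset, hnum]
    simp only [Prod.mk.injEq]
    rw [hden, mul_div_mul_left _ _ hp.ne', ha _ k.2, ha _ k.2.le]
  have hne : ∀ k (h : k ≤ n), a k ≠ 0 := by
    intro k h
    rw [ha k h, ← sum_outMass_take_eq]
    refine (Finset.sum_pos' (fun _ _ => ENNReal.toReal_nonneg)
      ⟨ω.2, ?_, ENNReal.toReal_pos (fun h => hω ?_) ((ch.outLaw ω.F).apply_ne_top ω.2)⟩).ne'
    · rw [Finset.mem_filter]
      exact ⟨Finset.mem_univ _, rfl⟩
    obtain ⟨f, yz⟩ := ω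
    rw [jointLaw_apply, show ch.outMass f yz = 0 from h, mul_zero]
  have htel : ∀ k ≤ n, ∏ i ∈ Finset.range k, a (i + 1) / a i = a k / a 0 := by
    intro k
    induction k with
    | zero => intro _; simp [div_self (hne 0 (Nat.zero_le n))]
    | succ k ih =>
      intro h
      rw [Finset.prod_range_succ, ih (by omega), mul_comm,
        div_mul_div_cancel₀ (hne k (by omega))]
  have h0 : a 0 = 1 := by
    rw [ha 0 (Nat.zero_le n), outProb]
    simp [outMass]
  rw [causalF, Finset.prod_congr rfl fun k _ => hstep k,
    Fin.prod_univ_eq_prod_range (fun i => a (i + 1) / a i) n, htel n le_rfl, h0, div_one,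
    ha n le_rfl]
  rfl

/-- Output distribution `p(y^n)`. -/
def outDist (y : Fin n → Y) : ℝ := ∑ f, (p f).toReal * ch.outProb f y

theorem pr_Ys (y : Fin n → Y) : pr (ch.jointLaw p) {ω | ω.Ys = y} = ch.outDist p y := by
  classical
  rw [pr_jointLaw]
  refine Finset.sum_congr rfl fun f _ => ?_
  rw [← show ch.outProb (f.upTo n le_rfl) y = ch.outProb f y from rfl,
    ← ch.sum_outMass_take_eq le_rfl f y]
  congr 1
  exact sum_filter_congr _ fun _ => Iff.rfl

/-- The residual directed information density is the information density between the
code-function and the channel outputs. -/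
theorem resDensity_eq (ω : Sample X Y Z n) (hω : ch.jointLaw p ω ≠ 0) :
    resDensity (ch.jointLaw p) ω =
      Real.logb 2 (ch.outProb ω.F ω.Ys / ch.outDist p ω.Ys) := by
  have hX := ch.causalX_pos p ω hω
  have hY : 0 < ch.outDist p ω.Ys := by
    rw [← pr_Ys]
    exact pr_pos _ _ ω rfl hω
  have hF : 0 < ch.outProb ω.F ω.Ys := by
    refine ch.outProb_pos ω.F ω.2 fun h => hω ?_
    obtain ⟨f, yz⟩ := ω
    rw [jointLaw_apply, show ch.outMass f yz = 0 from h, mul_zero]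
  -- Both logarithms now contain the same positive forward product, which drops out of the
  -- difference.
  rw [resDensity, dirDensity, condDirDensity, causalXF_eq _ _ _ hω, ← causalX_eq _ _ _ hω,
    causalF_eq _ _ _ hω, pr_Ys, Real.logb_div hX.ne' hY.ne', Real.logb_div hX.ne' hF.ne',
    Real.logb_div hF.ne' hY.ne']
  ring

/-- Expectations of functions of the residual directed information density. -/
theorem expect_comp_resDensity (φ : ℝ → ℝ) :
    expect (ch.jointLaw p) (fun ω => φ (resDensity (ch.jointLaw p) ω)) =
      ∑ f, ∑ y, (p f).toReal * ch.outProb f y *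
        φ (Real.logb 2 (ch.outProb f y / ch.outDist p y)) := by
  classical
  have h1 : expect (ch.jointLaw p) (fun ω => φ (resDensity (ch.jointLaw p) ω)) =
      expect (ch.jointLaw p)
        (fun ω => φ (Real.logb 2 (ch.outProb ω.F ω.Ys / ch.outDist p ω.Ys))) := by
    refine Finset.sum_congr rfl fun ω _ => ?_
    by_cases hω : ch.jointLaw p ω = 0
    · simp [hω]
    · simp only [resDensity_eq _ _ _ hω]
  rw [h1, expect, sum_jointLaw]
  refine Finset.sum_congr rfl fun f _ => ?_
  rw [Fintype.sum_prod_type, Finset.mul_sum]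
  refine Finset.sum_congr rfl fun y _ => ?_
  simp only [Sample.F, Sample.Ys, ← Finset.sum_mul]
  rw [← mul_assoc]
  rfl

theorem resInfo_eq_expect [Fintype X] :
    resInfo (ch.jointLaw p) = expect (ch.jointLaw p) (resDensity (ch.jointLaw p)) := by
  rw [resInfo, expect, expect, expect, ← Finset.sum_sub_distrib]
  exact Finset.sum_congr rfl fun ω _ => (mul_sub _ _ _).symm

end Channel

end Joint

/-! ### Every code-function law is good -/

section Good

variable {X Z : Type*} {n : ℕ}

/-- The event that the first `k` maps of the code-function send the feedback symbols `z` to the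
inputs `x`. -/
def prefixEvent (k : ℕ) (hk : k ≤ n) (x : Fin k → X) (z : Fin k → Z) : Set (CodeFn X Z n) :=
  {f | (f.upTo k hk).encode z = x}

theorem prefixEvent_succ {k : ℕ} (hk : k < n) (x : Fin n → X) (z : Fin n → Z) :
    prefixEvent (k + 1) hk (Fin.take (k + 1) hk x) (Fin.take (k + 1) hk z) =
      (prefixEvent k hk.le (Fin.take k hk.le x) (Fin.take k hk.le z) ∩
        {f | f ⟨k, hk⟩ (Fin.take k hk.le z) = x ⟨k, hk⟩} : Set (CodeFn X Z n)) := by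
  ext f
  constructor
  · intro h
    exact ⟨funext fun j => congrFun h j.castSucc, congrFun h (Fin.last k)⟩
  · rintro ⟨h1, h2⟩
    refine funext fun j => Fin.lastCases h2 (fun j => ?_) j
    exact congrFun h1 j

variable [Nonempty X]

open scoped Classical in
/-- The conditional law of the next channel input given the past inputs and feedback symbols, for a
random code-function. -/
def condInput (P : PMF (CodeFn X Z n)) (i : Fin n) (x : Fin i → X) (z : Fin i → Z) : PMF X :=
  if h : ∃ f ∈ prefixEvent i i.2.le x z, f ∈ P.support then
    (P.filter (prefixEvent i i.2.le x z) h).map fun f => f i z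
  -- A history of probability zero already makes the product vanish, so any value serves.
  else PMF.pure (Classical.arbitrary X)

/-- One step of the chain rule. The product form also covers null histories, where both sides are
zero. -/
theorem condInput_mul (P : PMF (CodeFn X Z n)) (i : Fin n) (x : Fin i → X) (z : Fin i → Z)
    (a : X) :
    P.toOuterMeasure (prefixEvent i i.2.le x z) * condInput P i x z a =
      P.toOuterMeasure (prefixEvent i i.2.le x z ∩ {f | f i z = a}) := by
  classical
  by_cases h : ∃ f ∈ prefixEvent i i.2.le x z, f ∈ P.support
  · rw [condInput, dif_pos h, PMF.map_apply]
    simp only [PMF.filter_apply]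
    have h1 : P.toOuterMeasure (prefixEvent i i.2.le x z) ≠ 0 := by
      rw [Ne, PMF.toOuterMeasure_apply_eq_zero_iff, Set.not_disjoint_iff]
      obtain ⟨f, hf, hf'⟩ := h
      exact ⟨f, hf', hf⟩
    have h2 : P.toOuterMeasure (prefixEvent i i.2.le x z) ≠ ⊤ := by
      rw [PMF.toOuterMeasure_apply]
      exact P.tsum_coe_indicator_ne_top _
    rw [← PMF.toOuterMeasure_apply, PMF.toOuterMeasure_apply _ (_ ∩ _)]
    rw [← ENNReal.tsum_mul_left]
    refine tsum_congr fun f => ?_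
    by_cases ha : a = f i z
    · rw [if_pos ha, mul_comm _ (P.toOuterMeasure _)⁻¹, ← mul_assoc, ENNReal.mul_inv_cancel h1 h2,
        one_mul]
      by_cases hf : f ∈ prefixEvent i i.2.le x z
      · rw [Set.indicator_of_mem hf, Set.indicator_of_mem (show f ∈ _ ∩ _ from ⟨hf, ha.symm⟩)]
      · rw [Set.indicator_of_notMem hf, Set.indicator_of_notMem fun h => hf h.1]
    · rw [if_neg ha, mul_zero, Set.indicator_of_notMem fun h => ha h.2.symm]
  · have h1 : P.toOuterMeasure (prefixEvent i i.2.le x z) = 0 := by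
      rw [PMF.toOuterMeasure_apply_eq_zero_iff, Set.disjoint_right]
      exact fun f hf hf' => h ⟨f, hf, hf'⟩
    rw [h1, zero_mul]
    exact (le_antisymm ((MeasureTheory.measure_mono Set.inter_subset_left).trans h1.le) bot_le).symm

theorem toOuterMeasure_prefixEvent (P : PMF (CodeFn X Z n)) (x : Fin n → X) (z : Fin n → Z) :
    ∀ (k : ℕ) (hk : k ≤ n),
      P.toOuterMeasure (prefixEvent k hk (Fin.take k hk x) (Fin.take k hk z)) =
        ∏ i : Fin k, condInput P (Fin.castLE hk i) (Fin.take i (i.2.le.trans hk) x)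
          (Fin.take i (i.2.le.trans hk) z) (x (Fin.castLE hk i))
  | 0, hk => by
    rw [Fin.prod_univ_zero, PMF.toOuterMeasure_apply_eq_one_iff]
    exact fun f _ => funext fun j => j.elim0
  | k + 1, hk => by
    rw [prefixEvent_succ, Fin.prod_univ_castSucc]
    refine (condInput_mul P ⟨k, hk⟩ _ _ _).symm.trans ?_
    rw [toOuterMeasure_prefixEvent P x z k (Nat.le_of_succ_le hk)]
    rfl

/-- Every family of code-function distributions is good with respect to some channel input
distributions. -/
theorem exists_goodFor (p : CodeFnLaw X Z) : ∃ q : InputLaw X Z, GoodFor p q :=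
  ⟨fun n => condInput (p n), fun n x z => toOuterMeasure_prefixEvent (p n) x z n le_rfl⟩

end Good

/-! ### One-shot coding and tail bounds for an abstract finite channel -/

section Coding

variable {A B : Type*} [Fintype A] [Fintype B]

theorem sum_le_one_of_sum_eq_one (W : B → ℝ) (hW : ∀ b, 0 ≤ W b) (hW1 : ∑ b, W b = 1)
    (s : Finset B) : ∑ b ∈ s, W b ≤ 1 :=
  hW1 ▸ Finset.sum_le_sum_of_subset_of_nonneg (Finset.subset_univ s) fun b _ _ => hW b

open scoped Classical in
/-- The greedy construction in Feinstein's lemma. -/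
theorem exists_disjoint_decoding_sets (p : A → ℝ) (hp : ∀ a, 0 ≤ p a) (hp1 : ∑ a, p a = 1)
    (W : A → B → ℝ) (hW : ∀ a b, 0 ≤ W a b) (hW1 : ∀ a, ∑ b, W a b = 1)
    (Q : B → ℝ) (hQ : ∀ b, Q b = ∑ a, p a * W a b) (T : ℝ) (hT : 0 < T) (M : ℕ) :
    ∀ k ≤ M, ∃ (f : ℕ → A) (D : ℕ → Finset B),
      (∀ i < k, ∀ b ∈ D i, T * Q b < W (f i) b) ∧
      (∀ i < k, ∀ j < k, i ≠ j → Disjoint (D i) (D j)) ∧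
      ∀ i < k, 1 - ((∑ a, ∑ b with W a b ≤ T * Q b, p a * W a b) + M / T) ≤
        ∑ b ∈ D i, W (f i) b := by
  have hA : Nonempty A := by
    by_contra h
    rw [not_nonempty_iff] at h
    simp at hp1
  intro k
  induction k with
  | zero =>
    intro _
    exact ⟨fun _ => hA.some, fun _ => ∅, by simp, by simp, by simp⟩
  | succ k ih =>
    intro hk
    obtain ⟨f, D, h1, h2, h3⟩ := ih (by omega)
    set ε := (∑ a, ∑ b with W a b ≤ T * Q b, p a * W a b) + M / T with hε
    let U : Finset B := (Finset.range k).biUnion D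
    -- Since `T * Q < W` on each decoding set and `W` has mass one, each set has `Q`-mass at most `1
    -- / T`. Strictness comes from `k < M`.
    have hU : ∑ b ∈ U, Q b < M / T := by
      have hQ0 : ∀ b, 0 ≤ Q b := fun b => by
        rw [hQ]; exact Finset.sum_nonneg fun a _ => mul_nonneg (hp a) (hW a b)
      have hD : ∀ i ∈ Finset.range k, ∑ b ∈ D i, Q b ≤ 1 / T := by
        intro i hi
        rw [le_div_iff₀' hT, Finset.mul_sum]
        refine (Finset.sum_le_sum fun b hb => (h1 i (Finset.mem_range.1 hi) b hb).le).trans ?_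
        exact sum_le_one_of_sum_eq_one _ (hW _) (hW1 _) _
      calc ∑ b ∈ U, Q b ≤ ∑ i ∈ Finset.range k, ∑ b ∈ D i, Q b := by
            rw [Finset.sum_biUnion]
            intro i hi j hj hij
            exact h2 i (by simpa using hi) j (by simpa using hj) hij
        _ ≤ ∑ i ∈ Finset.range k, 1 / T := Finset.sum_le_sum hD
        _ = k / T := by simp; ring
        _ < M / T := by
          have : (k : ℝ) < M := by exact_mod_cast hk
          gcongr
    -- Averaging over `p` turns the `W`-mass of `U` into its `Q`-mass, so the mean of these sums
    -- exceeds `1 - ε`; some `a` does at least as well.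
    obtain ⟨a, ha⟩ : ∃ a, 1 - ε ≤ ∑ b with T * Q b < W a b ∧ b ∉ U, W a b := by
      by_contra! hcon
      have hle : ∑ a, p a * ∑ b with T * Q b < W a b ∧ b ∉ U, W a b ≤ 1 - ε := by
        calc _ ≤ ∑ a, p a * (1 - ε) :=
              Finset.sum_le_sum fun a _ => mul_le_mul_of_nonneg_left (hcon a).le (hp a)
          _ = 1 - ε := by rw [← Finset.sum_mul, hp1, one_mul]
      have hge : ∀ a, p a - ∑ b with W a b ≤ T * Q b, p a * W a b - ∑ b ∈ U, p a * W a b ≤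
          p a * ∑ b with T * Q b < W a b ∧ b ∉ U, W a b := by
        intro a
        rw [← Finset.mul_sum, ← Finset.mul_sum]
        have : 1 ≤ (∑ b with T * Q b < W a b ∧ b ∉ U, W a b) +
            ((∑ b with W a b ≤ T * Q b, W a b) + ∑ b ∈ U, W a b) := by
          have hUs : ∑ b ∈ U, W a b = ∑ b, if b ∈ U then W a b else 0 := by
            simp [Finset.sum_ite_mem]
          rw [← hW1 a, Finset.sum_filter, Finset.sum_filter, hUs, ← Finset.sum_add_distrib, ← Finset.sum_add_distrib]
          refine Finset.sum_le_sum fun b _ => ?_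
          have := hW a b
          by_cases hb : T * Q b < W a b
          · by_cases hb' : b ∈ U <;> simp [hb, hb', not_le.2 hb]
          · by_cases hb' : b ∈ U <;> simp [hb, hb', not_lt.1 hb, this]
        nlinarith [hp a]
      have hsum := Finset.sum_le_sum fun a (_ : a ∈ Finset.univ) => hge a
      rw [Finset.sum_sub_distrib, Finset.sum_sub_distrib, hp1, Finset.sum_comm (s := Finset.univ)
        (t := U)] at hsum
      simp only [← hQ] at hsum
      linarith
    refine ⟨Function.update f k a,
      Function.update D k (Finset.univ.filter fun b => T * Q b < W a b ∧ b ∉ U), ?_, ?_, ?_⟩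
    · intro i hi b hb
      rcases eq_or_ne i k with rfl | hne
      · rw [Function.update_self] at hb ⊢
        exact (Finset.mem_filter.1 hb).2.1
      · rw [Function.update_of_ne hne] at hb ⊢
        exact h1 i (by omega) b hb
    · have hdis : ∀ i < k, Disjoint (D i) (Finset.univ.filter fun b => T * Q b < W a b ∧ b ∉ U) := by
        intro i hi
        rw [Finset.disjoint_right]
        intro b hb hb'
        exact (Finset.mem_filter.1 hb).2.2 (Finset.mem_biUnion.2 ⟨i, Finset.mem_range.2 hi, hb'⟩)
      intro i hi j hj hij
      rcases eq_or_ne i k with rfl | hne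
      · rw [Function.update_self, Function.update_of_ne hij.symm]
        exact (hdis j (by omega)).symm
      · rw [Function.update_of_ne hne]
        rcases eq_or_ne j k with rfl | hne'
        · rw [Function.update_self]
          exact hdis i (by omega)
        · rw [Function.update_of_ne hne']
          exact h2 i (by omega) j (by omega) hij
    · intro i hi
      rcases eq_or_ne i k with rfl | hne
      · rw [Function.update_self, Function.update_self]
        exact ha
      · rw [Function.update_of_ne hne, Function.update_of_ne hne]
        exact h3 i (by omega)

open scoped Classical in
/-- Feinstein's lemma, for the average probability of error. -/
theorem exists_code_sum_error_le (p : A → ℝ) (hp : ∀ a, 0 ≤ p a) (hp1 : ∑ a, p a = 1)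
    (W : A → B → ℝ) (hW : ∀ a b, 0 ≤ W a b) (hW1 : ∀ a, ∑ b, W a b = 1)
    (Q : B → ℝ) (hQ : ∀ b, Q b = ∑ a, p a * W a b) (T : ℝ) (hT : 0 < T) (M : ℕ) (hM : 0 < M) :
    ∃ (f : Fin M → A) (dec : B → Fin M),
      (∑ w, ∑ b with dec b ≠ w, W (f w) b) / M ≤
        (∑ a, ∑ b with W a b ≤ T * Q b, p a * W a b) + M / T := by
  obtain ⟨f, D, -, h2, h3⟩ :=
    exists_disjoint_decoding_sets p hp hp1 W hW hW1 Q hQ T hT M M le_rfl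
  -- Outputs outside all decoding sets are already counted as errors; their decoding is arbitrary.
  let dec : B → Fin M := fun b => if h : ∃ w : Fin M, b ∈ D w then h.choose else ⟨0, hM⟩
  have hdec : ∀ (w : Fin M) b, b ∈ D w → dec b = w := by
    intro w b hb
    have h : ∃ w : Fin M, b ∈ D w := ⟨w, hb⟩
    have hd : dec b = h.choose := dif_pos h
    rw [hd]
    by_contra hne
    exact Finset.disjoint_left.1 (h2 _ h.choose.2 w w.2 fun h' => hne (Fin.ext h')) h.choose_spec hb
  refine ⟨fun w => f w, dec, ?_⟩
  have hM' : (0 : ℝ) < M := by exact_mod_cast hM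
  rw [div_le_iff₀ hM']
  set ε := (∑ a, ∑ b with W a b ≤ T * Q b, p a * W a b) + M / T with hε
  have hw : ∀ w ∈ Finset.univ, ∑ b with dec b ≠ w, W (f w) b ≤ ε := by
    intro w _
    have hsub : Finset.univ.filter (fun b => dec b ≠ w) ⊆ (D w)ᶜ := by
      intro b hb
      rw [Finset.mem_compl]
      exact fun hb' => (Finset.mem_filter.1 hb).2 (hdec w b hb')
    have h4 := Finset.sum_le_sum_of_subset_of_nonneg hsub fun b _ _ => hW (f w) b
    have h5 := Finset.sum_add_sum_compl (D w) (W (f w))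
    have h6 := h3 w w.2
    rw [hW1] at h5
    linarith
  refine (Finset.sum_le_sum hw).trans_eq ?_
  simp [mul_comm]

open scoped Classical in
/-- The converse lemma of Verdú and Han. -/
theorem sum_low_density_le {M : ℕ} (hM : 0 < M) (V : Fin M → B → ℝ) (hV : ∀ w b, 0 ≤ V w b)
    (dec : B → Fin M) (Q : B → ℝ) (hQ : ∀ b, 0 ≤ Q b) (hQ1 : ∑ b, Q b = 1) (s : ℝ) (hs : 0 ≤ s) :
    (∑ w, ∑ b with V w b ≤ s * Q b, V w b) / M ≤
      (∑ w, ∑ b with dec b ≠ w, V w b) / M + s / M := by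
  rw [← add_div]
  have hM' : (0 : ℝ) < M := by exact_mod_cast hM
  refine div_le_div_of_nonneg_right ?_ hM'.le
  -- Low-density outputs decoded correctly have mass at most `s * Q`, and the decoding regions
  -- partition the output space.
  have h1 : ∑ w, ∑ b with dec b = w, s * Q b = s := by
    rw [Finset.sum_fiberwise, ← Finset.mul_sum, hQ1, mul_one]
  refine le_trans ?_ (add_le_add le_rfl h1.le)
  rw [← Finset.sum_add_distrib]
  refine Finset.sum_le_sum fun w _ => ?_
  simp only [Finset.sum_filter]
  rw [← Finset.sum_add_distrib]
  refine Finset.sum_le_sum fun b _ => ?_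
  have := hV w b
  have := mul_nonneg hs (hQ b)
  by_cases hd : dec b = w <;> by_cases hb : V w b ≤ s * Q b <;> simp [*]

open scoped Classical in
/-- The upper tail of the information density contributes little to its expectation. -/
theorem sum_density_le (p : A → ℝ) (hp : ∀ a, 0 ≤ p a) (hp1 : ∑ a, p a = 1)
    (W : A → B → ℝ) (hW : ∀ a b, 0 ≤ W a b) (hW1 : ∀ a, ∑ b, W a b = 1)
    (Q : B → ℝ) (hQ : ∀ b, Q b = ∑ a, p a * W a b) (α : ℝ) (hα : 0 ≤ α) :
    ∑ a, ∑ b, p a * W a b * Real.logb 2 (W a b / Q b) ≤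
      α + (∑ a, ∑ b with α < Real.logb 2 (W a b / Q b), p a * W a b) *
        Real.logb 2 (Fintype.card B) + 1 / Real.log 2 := by
  have hln : 0 < Real.log 2 := Real.log_pos one_lt_two
  obtain ⟨a₀⟩ : Nonempty A := by
    by_contra h
    rw [not_nonempty_iff] at h
    simp at hp1
  obtain ⟨b₀⟩ : Nonempty B := by
    by_contra h
    rw [not_nonempty_iff] at h
    simpa using hW1 a₀
  have hK : (1 : ℝ) ≤ Fintype.card B := by exact_mod_cast Fintype.card_pos_iff.2 ⟨b₀⟩
  have hK0 : (0 : ℝ) < Fintype.card B := by linarith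
  have hlogK : 0 ≤ Real.logb 2 (Fintype.card B) := Real.logb_nonneg one_lt_two hK
  have hQ0 : ∀ b, 0 ≤ Q b := fun b => by
    rw [hQ]; exact Finset.sum_nonneg fun a _ => mul_nonneg (hp a) (hW a b)
  -- On the tail, `W ≤ 1` bounds the density by `log (1 / Q) = log |B| + log (1 / (|B| Q))`, and
  -- `log t ≤ t` makes the last term sum to at most `1 / log 2`.
  have hpt : ∀ a b, p a * W a b * Real.logb 2 (W a b / Q b) ≤ p a * W a b * α +
      (if α < Real.logb 2 (W a b / Q b) then p a * W a b else 0) * Real.logb 2 (Fintype.card B) +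
      p a * W a b / Q b * (1 / Fintype.card B / Real.log 2) := by
    intro a b
    have hpW := mul_nonneg (hp a) (hW a b)
    have hlast : 0 ≤ p a * W a b / Q b * (1 / Fintype.card B / Real.log 2) :=
      mul_nonneg (div_nonneg hpW (hQ0 b)) (by positivity)
    rcases hpW.eq_or_lt with h0 | hpos
    · rw [← h0]; simp
    · have hWpos : 0 < W a b := pos_of_mul_pos_right hpos (hp a)
      have hQpos : 0 < Q b := by
        rw [hQ]
        exact hpos.trans_le (Finset.single_le_sum (f := fun a => p a * W a b)
          (fun a _ => mul_nonneg (hp a) (hW a b)) (Finset.mem_univ a))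
      split_ifs with h
      · have hW1' : W a b ≤ 1 := by
          simpa using sum_le_one_of_sum_eq_one (W a) (hW a) (hW1 a) {b}
        have h1 : Real.logb 2 (W a b / Q b) ≤
            Real.logb 2 (Fintype.card B) + 1 / Q b * (1 / Fintype.card B / Real.log 2) := by
          have h2 : Real.logb 2 (W a b / Q b) ≤ Real.logb 2 (1 / Q b) :=
            Real.logb_le_logb_of_le one_lt_two (by positivity) (by gcongr)
          have h3 : 1 / Q b = Fintype.card B * (1 / Q b * (1 / Fintype.card B)) := by
            field_simp
          have h4 : Real.log (1 / Q b * (1 / Fintype.card B)) ≤ 1 / Q b * (1 / Fintype.card B) := by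
            have := Real.log_le_sub_one_of_pos
              (show 0 < 1 / Q b * (1 / (Fintype.card B : ℝ)) by positivity)
            linarith
          rw [h3, Real.logb_mul hK0.ne' (by positivity)] at h2
          refine h2.trans (add_le_add le_rfl ?_)
          refine (div_le_div_of_nonneg_right h4 hln.le).trans_eq ?_
          ring
        have h5 := mul_le_mul_of_nonneg_left h1 hpos.le
        have h6 : 0 ≤ p a * W a b * α := by positivity
        calc _ ≤ _ := h5
          _ ≤ _ := by rw [mul_add, ← mul_assoc, mul_one_div]; linarith
      · rw [zero_mul, add_zero]
        have := mul_le_mul_of_nonneg_left (not_lt.1 h) hpos.le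
        linarith
  have hsum1 : ∑ a, ∑ b, p a * W a b * α = α := by
    simp only [← Finset.sum_mul, ← Finset.mul_sum, hW1, mul_one, hp1, one_mul]
  have hsum3 : ∑ a, ∑ b, p a * W a b / Q b ≤ Fintype.card B := by
    rw [Finset.sum_comm]
    simp only [← Finset.sum_div, ← hQ]
    refine (Finset.sum_le_sum fun b _ => div_self_le_one (Q b)).trans ?_
    simp
  calc _ ≤ ∑ a, ∑ b, (p a * W a b * α +
      (if α < Real.logb 2 (W a b / Q b) then p a * W a b else 0) * Real.logb 2 (Fintype.card B) +
      p a * W a b / Q b * (1 / Fintype.card B / Real.log 2)) :=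
        Finset.sum_le_sum fun a _ => Finset.sum_le_sum fun b _ => hpt a b
    _ ≤ _ := by
      simp only [Finset.sum_add_distrib]
      rw [hsum1]
      simp only [← Finset.sum_mul, ← Finset.sum_filter]
      refine add_le_add le_rfl ?_
      calc _ ≤ (Fintype.card B : ℝ) * (1 / Fintype.card B / Real.log 2) := by gcongr
        _ = _ := by field_simp

open scoped Classical in
/-- The lower tail of the information density contributes little to its expectation. -/
theorem le_sum_density (p : A → ℝ) (hp : ∀ a, 0 ≤ p a) (hp1 : ∑ a, p a = 1)
    (W : A → B → ℝ) (hW : ∀ a b, 0 ≤ W a b) (hW1 : ∀ a, ∑ b, W a b = 1)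
    (Q : B → ℝ) (hQ : ∀ b, Q b = ∑ a, p a * W a b) (β : ℝ) :
    β * (1 - ∑ a, ∑ b with Real.logb 2 (W a b / Q b) < β, p a * W a b) - 1 / Real.log 2 ≤
      ∑ a, ∑ b, p a * W a b * Real.logb 2 (W a b / Q b) := by
  have hln : 0 < Real.log 2 := Real.log_pos one_lt_two
  have hQ0 : ∀ b, 0 ≤ Q b := fun b => by
    rw [hQ]; exact Finset.sum_nonneg fun a _ => mul_nonneg (hp a) (hW a b)
  -- On the tail, `log (Q / W) ≤ Q / W` bounds the loss by `p * Q / log 2`, whose total is `1 / log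
  -- 2`.
  have hpt : ∀ a b, p a * W a b * β -
      β * (if Real.logb 2 (W a b / Q b) < β then p a * W a b else 0) - p a * Q b / Real.log 2 ≤
      p a * W a b * Real.logb 2 (W a b / Q b) := by
    intro a b
    have hpW := mul_nonneg (hp a) (hW a b)
    have hlast : 0 ≤ p a * Q b / Real.log 2 := div_nonneg (mul_nonneg (hp a) (hQ0 b)) hln.le
    rcases hpW.eq_or_lt with h0 | hpos
    · rw [← h0]; simpa using hlast
    · have hWpos : 0 < W a b := pos_of_mul_pos_right hpos (hp a)
      have hQpos : 0 < Q b := by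
        rw [hQ]
        exact hpos.trans_le (Finset.single_le_sum (f := fun a => p a * W a b)
          (fun a _ => mul_nonneg (hp a) (hW a b)) (Finset.mem_univ a))
      split_ifs with h
      · have h1 : Real.log (Q b / W a b) ≤ Q b / W a b := by
          have := Real.log_le_sub_one_of_pos (show 0 < Q b / W a b by positivity)
          linarith
        have h2 : -(Q b / W a b / Real.log 2) ≤ Real.logb 2 (W a b / Q b) := by
          rw [← inv_div (Q b) (W a b), Real.logb_inv, Real.logb]
          exact neg_le_neg (div_le_div_of_nonneg_right h1 hln.le)
        have h3 := mul_le_mul_of_nonneg_left h2 hpos.le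
        have h4 : p a * W a b * -(Q b / W a b / Real.log 2) = -(p a * Q b / Real.log 2) := by
          field_simp
        linarith
      · have := mul_le_mul_of_nonneg_left (not_lt.1 h) hpos.le
        linarith
  have hsum1 : ∑ a, ∑ b, p a * W a b * β = β := by
    simp only [← Finset.sum_mul, ← Finset.mul_sum, hW1, mul_one, hp1, one_mul]
  have hQ1 : ∑ b, Q b = 1 := by
    simp only [hQ]
    rw [Finset.sum_comm]
    simp only [← Finset.mul_sum, hW1, mul_one, hp1]
  have hsum3 : ∑ a, ∑ b, p a * Q b / Real.log 2 = 1 / Real.log 2 := by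
    simp only [← Finset.sum_div, ← Finset.mul_sum, hQ1, mul_one, hp1]
  refine le_trans (le_of_eq ?_)
    (Finset.sum_le_sum fun a _ => Finset.sum_le_sum fun b (_ : b ∈ Finset.univ) => hpt a b)
  simp only [Finset.sum_sub_distrib]
  rw [hsum1, hsum3]
  simp only [← Finset.mul_sum, ← Finset.sum_filter]
  ring

end Coding

/-! ### One-shot bounds for the channel with noisy feedback -/

theorem sum_map_uniformOfFintype {X Z : Type*} {n M : ℕ} [Finite X] [Finite Z] [Nonempty (Fin M)] (enc : Fin M → CodeFn X Z n)
    (g : CodeFn X Z n → ℝ) :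
    ∑ f, ((PMF.uniformOfFintype (Fin M)).map enc f).toReal * g f = (∑ w, g (enc w)) / M := by
  classical
  have h : ∀ f, ((PMF.uniformOfFintype (Fin M)).map enc f).toReal =
      ∑ w, if f = enc w then (M : ℝ)⁻¹ else 0 := by
    intro f
    rw [PMF.map_apply, tsum_fintype, ENNReal.toReal_sum]
    · refine Finset.sum_congr rfl fun w _ => ?_
      split_ifs <;> simp
    · intro w _
      split_ifs
      · exact PMF.apply_ne_top _ _
      · simp
  simp only [h, Finset.sum_mul]
  rw [Finset.sum_comm, Finset.sum_div]
  refine Finset.sum_congr rfl fun w _ => ?_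
  simp [div_eq_inv_mul]

namespace Channel

variable {X Y Z : Type*} [Fintype Y] [Fintype Z] {n M : ℕ} (ch : Channel X Y Z)

theorem pr_outLaw (f : CodeFn X Z n) (Q : (Fin n → Y) → Prop) [DecidablePred Q] :
    pr (ch.outLaw f) {yz | Q yz.1} = ∑ y with Q y, ch.outProb f y := by
  have h1 : pr (ch.outLaw f) {yz | Q yz.1} = ∑ yz with Q yz.1, (ch.outMass f yz).toReal := by
    classical
    rw [pr_eq_sum]
    exact sum_filter_congr _ fun _ => Iff.rfl
  rw [h1, Finset.sum_filter, Fintype.sum_prod_type, Finset.sum_filter]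
  refine Finset.sum_congr rfl fun y _ => ?_
  by_cases h : Q y <;> simp [h, outProb]

theorem errorProb_eq (c : Code X Y Z n M) :
    ch.errorProb c = (∑ w, ∑ y with c.dec y ≠ w, ch.outProb (c.enc w) y) / M := by
  rw [errorProb]
  congr 1
  exact Finset.sum_congr rfl fun w _ => ch.pr_outLaw _ fun y => c.dec y ≠ w

theorem errorProb_le_one (c : Code X Y Z n M) : ch.errorProb c ≤ 1 := by
  classical
  refine div_le_one_of_le₀ ?_ (Nat.cast_nonneg M)
  refine (Finset.sum_le_card_nsmul _ _ 1 fun w _ => ?_).trans_eq (by simp)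
  rw [ch.pr_outLaw _ fun y => c.dec y ≠ w]
  exact sum_le_one_of_sum_eq_one _ (ch.outProb_nonneg _) (ch.sum_outProb _) _

section Outputs

variable [Finite X] (p : PMF (CodeFn X Z n))

open scoped Classical in
theorem pr_resDensity (Q : ℝ → Prop) :
    pr (ch.jointLaw p) {ω | Q (resDensity (ch.jointLaw p) ω)} =
      ∑ f, ∑ y with Q (Real.logb 2 (ch.outProb f y / ch.outDist p y)),
        (p f).toReal * ch.outProb f y := by
  have h := ch.expect_comp_resDensity p fun t => if Q t then 1 else 0
  simp only [expect, mul_ite, mul_one, mul_zero, ← Finset.sum_filter] at h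
  rw [← h, pr_eq_sum]
  exact sum_filter_congr _ fun _ => Iff.rfl

set_option linter.unusedSectionVars false in
theorem outDist_nonneg (y : Fin n → Y) : 0 ≤ ch.outDist p y :=
  Finset.sum_nonneg fun f _ => mul_nonneg ENNReal.toReal_nonneg (ch.outProb_nonneg f y)

theorem sum_outDist : ∑ y, ch.outDist p y = 1 := by
  simp only [outDist]
  rw [Finset.sum_comm]
  simp only [← Finset.mul_sum, sum_outProb, mul_one, sum_toReal]

-- Passing to logarithms is legitimate wherever the weight is positive; elsewhere the conventions
-- for division by zero and `log 0` are harmless.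
open scoped Classical in
theorem sum_low_outProb_le (T : ℝ) (hT : 0 < T) :
    ∑ f, ∑ y with ch.outProb f y ≤ T * ch.outDist p y, (p f).toReal * ch.outProb f y ≤
      pr (ch.jointLaw p) {ω | resDensity (ch.jointLaw p) ω ≤ Real.logb 2 T} := by
  rw [ch.pr_resDensity p fun t => t ≤ Real.logb 2 T]
  refine Finset.sum_le_sum fun f _ => ?_
  rw [Finset.sum_filter, Finset.sum_filter]
  refine Finset.sum_le_sum fun y _ => ?_
  have h0 : 0 ≤ (p f).toReal * ch.outProb f y :=
    mul_nonneg ENNReal.toReal_nonneg (ch.outProb_nonneg f y)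
  split_ifs with h1 h2 h2
  · exact le_rfl
  · rcases h0.eq_or_lt with h0 | hpos
    · exact h0.symm.le
    · refine absurd ?_ h2
      have hW : 0 < ch.outProb f y := pos_of_mul_pos_right hpos ENNReal.toReal_nonneg
      have hQ : 0 < ch.outDist p y := pos_of_mul_pos_right (hW.trans_le h1) hT.le
      exact Real.logb_le_logb_of_le one_lt_two (div_pos hW hQ) ((div_le_iff₀ hQ).2 h1)
  · exact h0
  · exact le_rfl

/-- Feinstein's lemma for the channel with noisy feedback. -/
theorem exists_code_errorProb_le (hM : 0 < M) (γ : ℝ) :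
    ∃ c : Code X Y Z n M, ch.errorProb c ≤
      pr (ch.jointLaw p) {ω | resDensity (ch.jointLaw p) ω ≤ Real.logb 2 M + γ} +
        (2 : ℝ) ^ (-γ) := by
  classical
  have hM' : (0 : ℝ) < M := by exact_mod_cast hM
  have h2 : (0 : ℝ) < 2 ^ γ := Real.rpow_pos_of_pos two_pos γ
  -- The threshold `T = M * 2 ^ γ` has logarithm `log M + γ` and gives `M / T = 2 ^ (-γ)`.
  obtain ⟨f, dec, h⟩ := exists_code_sum_error_le (fun f => (p f).toReal)
    (fun _ => ENNReal.toReal_nonneg) (sum_toReal p) ch.outProb ch.outProb_nonneg ch.sum_outProb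
    (ch.outDist p) (fun _ => rfl) (M * 2 ^ γ) (mul_pos hM' h2) M hM
  refine ⟨⟨f, dec⟩, ?_⟩
  have hlog : Real.logb 2 (M * 2 ^ γ) = Real.logb 2 M + γ := by
    rw [Real.logb_mul hM'.ne' h2.ne', Real.logb_rpow two_pos (by norm_num)]
  have h3 := ch.sum_low_outProb_le p (M * 2 ^ γ) (mul_pos hM' h2)
  have h4 : (M : ℝ) / (M * 2 ^ γ) = 2 ^ (-γ) := by
    rw [Real.rpow_neg two_pos.le]
    field_simp
  rw [hlog] at h3
  rw [h4] at h
  rw [errorProb_eq]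
  refine le_trans (le_of_eq ?_) (h.trans (add_le_add h3 le_rfl))
  congr!

/-- The Verdú–Han converse for the channel with noisy feedback. -/
theorem exists_law_pr_resDensity_le [Nonempty Y] (c : Code X Y Z n M) :
    ∃ p : PMF (CodeFn X Z n), ∀ γ : ℝ,
      pr (ch.jointLaw p) {ω | resDensity (ch.jointLaw p) ω ≤ Real.logb 2 M - γ} ≤
        ch.errorProb c + (2 : ℝ) ^ (-γ) := by
  classical
  have hF : Nonempty (Fin M) := ⟨c.dec (Classical.arbitrary _)⟩
  have hM : 0 < M := Fin.pos_iff_nonempty.2 hF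
  have hM' : (0 : ℝ) < M := by exact_mod_cast hM
  -- A uniform message induces this law, which serves every `γ`. Messages sharing a code-function
  -- add their weights.
  refine ⟨(PMF.uniformOfFintype (Fin M)).map c.enc, fun γ => ?_⟩
  set p := (PMF.uniformOfFintype (Fin M)).map c.enc with hp
  have h2 : (0 : ℝ) < 2 ^ (-γ) := Real.rpow_pos_of_pos two_pos _
  have hlog : Real.logb 2 (M * 2 ^ (-γ)) = Real.logb 2 M - γ := by
    rw [Real.logb_mul hM'.ne' h2.ne', Real.logb_rpow two_pos (by norm_num), sub_eq_add_neg]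
  have h := sum_low_density_le hM (fun w => ch.outProb (c.enc w)) (fun w => ch.outProb_nonneg _)
    c.dec (ch.outDist p) (ch.outDist_nonneg p) (ch.sum_outDist p) (M * 2 ^ (-γ)) (by positivity)
  rw [mul_div_cancel_left₀ _ hM'.ne'] at h
  rw [← ch.errorProb_eq c] at h
  refine le_trans ?_ h
  rw [← hlog, ch.pr_resDensity p fun t => t ≤ Real.logb 2 (M * 2 ^ (-γ))]
  simp only [← Finset.mul_sum]
  rw [sum_map_uniformOfFintype]
  refine div_le_div_of_nonneg_right (Finset.sum_le_sum fun w _ => ?_) hM'.le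
  rw [Finset.sum_filter, Finset.sum_filter]
  refine Finset.sum_le_sum fun y _ => ?_
  have h0 := ch.outProb_nonneg (c.enc w) y
  rcases h0.eq_or_lt with h0 | hpos
  · rw [← h0]; simp
  · have hQ : 0 < ch.outDist p y := by
      rw [outDist, hp, sum_map_uniformOfFintype]
      exact div_pos (Finset.sum_pos' (fun _ _ => ch.outProb_nonneg _ _)
        ⟨w, Finset.mem_univ w, hpos⟩) hM'
    have hiff : Real.logb 2 (ch.outProb (c.enc w) y / ch.outDist p y) ≤
        Real.logb 2 (M * 2 ^ (-γ)) ↔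
        ch.outProb (c.enc w) y ≤ M * 2 ^ (-γ) * ch.outDist p y := by
      rw [Real.logb_le_logb one_lt_two (div_pos hpos hQ) (by positivity), div_le_iff₀ hQ]
    simp only [hiff]
    exact le_rfl

theorem resInfo_le [Fintype X] (α : ℝ) (hα : 0 ≤ α) :
    resInfo (ch.jointLaw p) ≤
      α + pr (ch.jointLaw p) {ω | resDensity (ch.jointLaw p) ω > α} *
        (n * Real.logb 2 (Fintype.card Y)) + 1 / Real.log 2 := by
  classical
  have h := sum_density_le (fun f => (p f).toReal)
    (fun _ => ENNReal.toReal_nonneg) (sum_toReal p) ch.outProb ch.outProb_nonneg ch.sum_outProb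
    (ch.outDist p) (fun _ => rfl) α hα
  have hcard : Real.logb 2 (Fintype.card (Fin n → Y)) = n * Real.logb 2 (Fintype.card Y) := by
    simp [Real.logb_pow]
  rw [hcard, ← ch.pr_resDensity p fun t => α < t, ← ch.expect_comp_resDensity p fun t => t] at h
  rw [resInfo_eq_expect]
  exact h

theorem le_resInfo [Fintype X] (β : ℝ) :
    β * (1 - pr (ch.jointLaw p) {ω | resDensity (ch.jointLaw p) ω < β}) - 1 / Real.log 2 ≤
      resInfo (ch.jointLaw p) := by
  classical
  have h := le_sum_density (fun f => (p f).toReal)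
    (fun _ => ENNReal.toReal_nonneg) (sum_toReal p) ch.outProb ch.outProb_nonneg ch.sum_outProb
    (ch.outDist p) (fun _ => rfl) β
  rw [← ch.pr_resDensity p fun t => t < β, ← ch.expect_comp_resDensity p fun t => t] at h
  rw [resInfo_eq_expect]
  exact h

end Outputs

end Channel

/-! ### Limits in probability and diagonal sequences -/

section Events

variable {Ω : Type*} [Fintype Ω] (P : PMF Ω)

theorem pr_mono {s t : Set Ω} (h : s ⊆ t) : pr P s ≤ pr P t := by
  classical
  rw [pr_eq_sum, pr_eq_sum]
  exact Finset.sum_le_sum_of_subset_of_nonneg (Finset.monotone_filter_right _ fun ω _ hω => h hω)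
    fun _ _ _ => ENNReal.toReal_nonneg

theorem pr_add_pr_compl (s : Set Ω) : pr P s + pr P sᶜ = 1 := by
  classical
  rw [pr_eq_sum, pr_eq_sum, ← Channel.sum_toReal P, ← Finset.sum_filter_add_sum_filter_not
    Finset.univ (· ∈ s)]
  exact congrArg _ (sum_filter_congr _ fun _ => Iff.rfl)

end Events

/-- A diagonal sequence for a decreasing sequence of properties. -/
theorem exists_diagonal {α : ℕ → Type*} [∀ n, Nonempty (α n)] (Q : ℕ → (n : ℕ) → α n → Prop)
    (hQ : ∀ n x, ∀ j k, j ≤ k → Q k n x → Q j n x) (h : ∀ k, ∀ᶠ n in atTop, ∃ x, Q k n x) :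
    ∃ x : (n : ℕ) → α n, ∀ k, ∀ᶠ n in atTop, Q k n (x n) := by
  classical
  -- The strongest property with index at most `n` that can be met at `n`; it eventually passes
  -- every `k`.
  let K : ℕ → ℕ := fun n => Nat.findGreatest (fun k => ∃ x, Q k n x) n
  refine ⟨fun n => if hx : ∃ x, Q (K n) n x then hx.choose else Classical.arbitrary _, fun k => ?_⟩
  filter_upwards [h k, eventually_ge_atTop k] with n hn hkn
  have hx : ∃ x, Q (K n) n x := Nat.findGreatest_spec (P := fun k => ∃ x, Q k n x) hkn hn
  have hk : k ≤ K n := Nat.le_findGreatest (P := fun k => ∃ x, Q k n x) hkn hn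
  rw [dif_pos hx]
  exact hQ n _ k (K n) hk hx.choose_spec

theorem tendsto_two_rpow_neg_mul {δ : ℝ} (hδ : 0 < δ) :
    Tendsto (fun n : ℕ => (2 : ℝ) ^ (-(n * δ))) atTop (𝓝 0) := by
  have h : ∀ n : ℕ, (2 : ℝ) ^ (-(n * δ)) = ((2 : ℝ) ^ (-δ)) ^ n := by
    intro n
    rw [← Real.rpow_natCast, ← Real.rpow_mul two_pos.le]
    congr 1
    ring
  simp only [h]
  exact tendsto_pow_atTop_nhds_zero_of_lt_one (Real.rpow_nonneg two_pos.le _)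
    (Real.rpow_lt_one_of_one_lt_of_neg one_lt_two (neg_lt_zero.2 hδ))

/-! ### Inf-rates, sup-rates and capacity -/

namespace Channel

theorem nonempty_output {X Y Z : Type*} [Nonempty X] (ch : Channel X Y Z) : Nonempty Y :=
  let ⟨y, _⟩ := (ch.forward 0 (fun _ => Classical.arbitrary X) Fin.elim0).support_nonempty
  ⟨y⟩

variable {X Y Z : Type*} [Fintype X] [Fintype Y] [Fintype Z] (ch : Channel X Y Z)

/-- Every rate below a threshold that the normalized density exceeds with non-negligible
probability is attained by codes whose error probability is controlled by that probability. -/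
theorem exists_codes_of_lt (p : CodeFnLaw X Z) {R β : ℝ} (hR : 0 ≤ R) (hβ : R < β) :
    ∃ (M : ℕ → ℕ) (c : (n : ℕ) → Code X Y Z n (M n)) (e : ℕ → ℝ),
      (∀ᶠ n : ℕ in atTop, R ≤ Real.logb 2 (M n) / n) ∧ Tendsto e atTop (𝓝 0) ∧
      ∀ᶠ n : ℕ in atTop, ch.errorProb (c n) ≤
        pr (ch.jointLaw (p n)) {ω | resDensity (ch.jointLaw (p n)) ω / n < β} + e n := by
  have hM : ∀ n : ℕ, 0 < ⌈(2 : ℝ) ^ (n * R)⌉₊ := fun n =>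
    Nat.ceil_pos.2 (Real.rpow_pos_of_pos two_pos _)
  choose c hc using fun n : ℕ =>
    ch.exists_code_errorProb_le (p n) (hM n) (n * ((β - R) / 2))
  refine ⟨_, c, _, ?_, tendsto_two_rpow_neg_mul (half_pos (sub_pos.2 hβ)), ?_⟩
  · filter_upwards [eventually_gt_atTop 0] with n hn
    have hn' : (0 : ℝ) < n := by exact_mod_cast hn
    rw [le_div_iff₀ hn', Real.le_logb_iff_rpow_le one_lt_two (by exact_mod_cast hM n), mul_comm]
    exact Nat.le_ceil _
  -- Half of the gap `n * (β - R)` is spent on `γ`; the other half absorbs the bit lost to the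
  -- ceiling.
  · have hlarge : ∀ᶠ n : ℕ in atTop, 1 < n * ((β - R) / 2) :=
      (tendsto_natCast_atTop_atTop.atTop_mul_const (half_pos (sub_pos.2 hβ))).eventually_gt_atTop 1
    filter_upwards [eventually_gt_atTop 0, hlarge] with n hn hn1
    have hn' : (0 : ℝ) < n := by exact_mod_cast hn
    refine (hc n).trans (add_le_add (pr_mono _ fun ω hω => ?_) le_rfl)
    have hlog : Real.logb 2 (⌈(2 : ℝ) ^ (n * R)⌉₊ : ℕ) ≤ n * R + 1 := by
      rw [Real.logb_le_iff_le_rpow one_lt_two (by exact_mod_cast hM n),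
        Real.rpow_add two_pos, Real.rpow_one]
      have h1 := (Nat.ceil_lt_add_one (Real.rpow_nonneg two_pos.le (n * R))).le
      have h2 : (1 : ℝ) ≤ 2 ^ (n * R) := Real.one_le_rpow one_le_two (by positivity)
      linarith
    have hω' : resDensity (ch.jointLaw (p n)) ω ≤
      Real.logb 2 (⌈(2 : ℝ) ^ (n * R)⌉₊ : ℕ) + n * ((β - R) / 2) := hω
    show resDensity (ch.jointLaw (p n)) ω / n < β
    rw [div_lt_iff₀ hn']
    nlinarith

variable [Nonempty X]

set_option linter.unusedSectionVars false in
theorem isAchievable_zero {ε : ℝ} (hε : 0 < ε) : ch.IsAchievable ε 0 := by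
  refine ⟨le_rfl, fun δ hδ => Eventually.of_forall fun n => ⟨1,
    ⟨fun _ _ _ => Classical.arbitrary X, fun _ => 0⟩, ?_, ?_⟩⟩
  · simp [errorProb, pr, hε.le]
  · simp [hδ.le]

theorem capacity_nonneg : 0 ≤ ch.capacity :=
  le_iSup₂_of_le (f := fun (R : ℝ) (_ : ∀ ε : ℝ, 0 < ε → ε < 1 → ch.IsAchievable ε R) => (R : EReal))
    0 (fun _ hε _ => ch.isAchievable_zero hε) EReal.coe_zero.ge

theorem infRate_le_capacity (p : CodeFnLaw X Z) : ch.infRate p ≤ ch.capacity := by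
  refine iSup₂_le fun β hβ => EReal.ge_of_forall_gt_iff_ge.1 fun R hR => ?_
  have hR : R < β := by exact_mod_cast hR
  rcases lt_or_ge R 0 with h0 | h0
  · exact le_trans (by exact_mod_cast h0.le) ch.capacity_nonneg
  refine le_iSup₂_of_le (f := fun (R : ℝ)
    (_ : ∀ ε : ℝ, 0 < ε → ε < 1 → ch.IsAchievable ε R) => (R : EReal))
    R (fun ε hε _ => ⟨h0, fun δ hδ => ?_⟩) le_rfl
  obtain ⟨M, c, e, h1, h2, h3⟩ := ch.exists_codes_of_lt p h0 hR
  have h4 := (hβ.add h2).eventually_le_const (show (0 : ℝ) + 0 < ε by simpa using hε)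
  filter_upwards [h1, h3, h4] with n h1 h3 h4
  exact ⟨M n, c n, h3.trans h4, by linarith⟩

/-- Otherwise Feinstein codes exist at a rate `R` above capacity. Their errors tend to one, which
forces the density below some `β > R` with probability tending to one, where `β` is less than the
sup-rate. -/
theorem supRate_le_capacity (h : ch.HasStrongConverse) (p : CodeFnLaw X Z) :
    ch.supRate p ≤ ch.capacity := by
  by_contra! hlt
  obtain ⟨R, hR1, hR2⟩ := EReal.lt_iff_exists_real_btwn.1 hlt
  obtain ⟨β, hβ1, hβ2⟩ := EReal.lt_iff_exists_real_btwn.1 hR2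
  have hR0 : 0 ≤ R := by exact_mod_cast (ch.capacity_nonneg.trans_lt hR1).le
  obtain ⟨M, c, e, h1, h2, h3⟩ := ch.exists_codes_of_lt p hR0 (by exact_mod_cast hβ1)
  have hlim : (R : EReal) ≤ liminf (fun n : ℕ => ((Real.logb 2 (M n) / n : ℝ) : EReal)) atTop := by
    refine le_liminf_of_le (by isBoundedDefault) ?_
    filter_upwards [h1] with n h1
    exact_mod_cast h1
  have h4 := h R hR1 M c hlim
  have h5 : Tendsto (fun n => 1 - ch.errorProb (c n) + e n) atTop (𝓝 0) := by
    simpa using (h4.const_sub 1).add h2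
  refine hβ2.not_ge (iInf₂_le β (squeeze_zero' (Eventually.of_forall fun n => pr_nonneg _ _) ?_ h5))
  filter_upwards [h3] with n h3
  have h6 := pr_add_pr_compl (ch.jointLaw (p n))
    {ω | resDensity (ch.jointLaw (p n)) ω / n < β}
  have h7 : pr (ch.jointLaw (p n)) {ω | resDensity (ch.jointLaw (p n)) ω / n > β} ≤
      pr (ch.jointLaw (p n)) {ω | resDensity (ch.jointLaw (p n)) ω / n < β}ᶜ :=
    pr_mono _ fun ω (hω : β < _) => show ¬ _ < β from not_lt.2 hω.le
  linarith

theorem eventually_exists_law_of_lt_capacity {R : ℝ} (hR : R < ch.capacity) {ε : ℝ} (hε : 0 < ε) :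
    ∀ᶠ n : ℕ in atTop, ∃ p : PMF (CodeFn X Z n),
      pr (ch.jointLaw p) {ω | resDensity (ch.jointLaw p) ω / n < R} ≤ ε := by
  have hY := ch.nonempty_output
  obtain ⟨R', hR'⟩ := lt_iSup_iff.1 hR
  obtain ⟨hach, hlt⟩ := lt_iSup_iff.1 hR'
  have hlt : R < R' := by exact_mod_cast hlt
  have hδ : 0 < (R' - R) / 2 := by linarith
  have hmin : min (ε / 2) (1 / 2) < 1 := (min_le_right _ _).trans_lt (by norm_num)
  -- Achievability is assumed only for errors below one, hence the minimum. The gap `R' - R` is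
  -- split between the rate slack and `γ`.
  filter_upwards [(hach (min (ε / 2) (1 / 2)) (by positivity) hmin).2 _ hδ,
    (tendsto_two_rpow_neg_mul hδ).eventually_le_const (half_pos hε), eventually_gt_atTop 0]
    with n ⟨M, c, hc, hM⟩ h2 hn
  have hn' : (0 : ℝ) < n := by exact_mod_cast hn
  obtain ⟨p, hp⟩ := ch.exists_law_pr_resDensity_le c
  refine ⟨p, (pr_mono _ fun ω hω => ?_).trans ((hp (n * ((R' - R) / 2))).trans ?_)⟩
  · have hω' : resDensity (ch.jointLaw p) ω / n < R := hω
    rw [div_lt_iff₀ hn'] at hω'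
    rw [le_div_iff₀ hn'] at hM
    show resDensity (ch.jointLaw p) ω ≤ Real.logb 2 M - n * ((R' - R) / 2)
    nlinarith
  · have := min_le_left (ε / 2) (1 / 2)
    linarith

theorem exists_capacity_le_infRate : ∃ p : CodeFnLaw X Z, ch.capacity ≤ ch.infRate p := by
  have hbot : (⊥ : EReal) < ch.capacity := EReal.bot_lt_zero.trans_le ch.capacity_nonneg
  -- Real levels increasing to capacity; the diagonal law meets each with vanishing failure
  -- probability.
  obtain ⟨u, humono, hu, hulim⟩ := exists_seq_strictMono_tendsto' hbot
  have hcoe : ∀ k, ((u k).toReal : EReal) = u k := fun k =>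
    EReal.coe_toReal ((hu k).2.trans_le le_top).ne (hu k).1.ne'
  have hmono : ∀ j k, j ≤ k → (u j).toReal ≤ (u k).toReal := by
    intro j k hjk
    rw [← EReal.coe_le_coe_iff, hcoe, hcoe]
    exact humono.monotone hjk
  have hne : ∀ n, Nonempty (PMF (CodeFn X Z n)) := fun n =>
    ⟨PMF.pure fun _ _ => Classical.arbitrary X⟩
  obtain ⟨p, hp⟩ := exists_diagonal (α := fun n => PMF (CodeFn X Z n))
    (fun k n p => pr (ch.jointLaw p)
      {ω | resDensity (ch.jointLaw p) ω / n < (u k).toReal} ≤ 1 / ((k : ℝ) + 1))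
    (fun n p j k hjk h => (pr_mono _ fun ω hω => lt_of_lt_of_le hω (hmono j k hjk)).trans
      (h.trans (Nat.one_div_le_one_div hjk)))
    (fun k => ch.eventually_exists_law_of_lt_capacity (by rw [hcoe]; exact (hu k).2)
      Nat.one_div_pos_of_nat)
  refine ⟨p, le_of_tendsto' hulim fun k => ?_⟩
  rw [← hcoe k]
  refine le_iSup₂_of_le (f := fun (β : ℝ) (_ : Tendsto (fun n => pr (ch.jointLaw (p n))
    {ω | resDensity (ch.jointLaw (p n)) ω / n < β}) atTop (𝓝 0)) => (β : EReal))
    (u k).toReal ?_ le_rfl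
  refine tendsto_order.2 ⟨fun a ha => Eventually.of_forall fun n => ha.trans_le (pr_nonneg _ _),
    fun a ha => ?_⟩
  obtain ⟨j, hj⟩ := exists_nat_one_div_lt ha
  filter_upwards [hp (max j k)] with n hn
  refine (pr_mono _ fun ω hω => ?_).trans_lt
    ((hn.trans (Nat.one_div_le_one_div (le_max_left j k))).trans_lt hj)
  exact lt_of_lt_of_le hω (hmono _ _ (le_max_right j k))

set_option linter.unusedSectionVars false in
theorem infRate_le_supRate (p : CodeFnLaw X Z) : ch.infRate p ≤ ch.supRate p := by
  refine iSup₂_le fun β hβ => le_iInf₂ fun α hα => ?_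
  by_contra! hlt
  have hlt : α < β := by exact_mod_cast hlt
  refine absurd (ge_of_tendsto' (hβ.add hα) (b := 1) fun n => ?_) (by norm_num)
  refine (pr_add_pr_compl (ch.jointLaw (p n))
    {ω | resDensity (ch.jointLaw (p n)) ω / n < β}).ge.trans (add_le_add le_rfl ?_)
  exact pr_mono _ fun ω hω => hlt.trans_le (not_lt.1 hω)

/-- The Verdú–Han laws of the codes have sup-rate below `R`, so their density almost surely in the
limit lies below a level `α < R`. With `γ = n * (R' - α)` the bound then pushes the error to one. -/
theorem hasStrongConverse_of_supRate_le (h : ∀ p : CodeFnLaw X Z, ch.supRate p ≤ ch.capacity) :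
    ch.HasStrongConverse := by
  have hY := ch.nonempty_output
  intro R hR M c hlim
  choose p hp using fun n => ch.exists_law_pr_resDensity_le (c n)
  obtain ⟨α, hα⟩ := iInf_lt_iff.1 ((h p).trans_lt hR)
  obtain ⟨hα, hαR⟩ := iInf_lt_iff.1 hα
  obtain ⟨R', h1, h2⟩ := EReal.lt_iff_exists_real_btwn.1 hαR
  have h1 : α < R' := by exact_mod_cast h1
  have hlow : Tendsto (fun n => 1 - pr (ch.jointLaw (p n))
      {ω | resDensity (ch.jointLaw (p n)) ω / n > α} - (2 : ℝ) ^ (-(n * (R' - α)))) atTop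
      (𝓝 1) := by
    simpa using (hα.const_sub 1).sub (tendsto_two_rpow_neg_mul (sub_pos.2 h1))
  refine tendsto_of_tendsto_of_tendsto_of_le_of_le' hlow tendsto_const_nhds ?_
    (Eventually.of_forall fun n => ch.errorProb_le_one _)
  filter_upwards [eventually_lt_of_lt_liminf (h2.trans_le hlim) (by isBoundedDefault),
    eventually_gt_atTop 0] with n hn hn0
  have hn : R' < Real.logb 2 (M n) / n := by exact_mod_cast hn
  have hn' : (0 : ℝ) < n := by exact_mod_cast hn0
  rw [lt_div_iff₀ hn'] at hn
  have h3 := hp n (n * (R' - α))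
  have h4 := pr_add_pr_compl (ch.jointLaw (p n)) {ω | resDensity (ch.jointLaw (p n)) ω / n > α}
  have h5 : pr (ch.jointLaw (p n)) {ω | resDensity (ch.jointLaw (p n)) ω / n > α}ᶜ ≤
      pr (ch.jointLaw (p n))
        {ω | resDensity (ch.jointLaw (p n)) ω ≤ Real.logb 2 (M n) - n * (R' - α)} := by
    refine pr_mono _ fun ω hω => ?_
    have hω' : resDensity (ch.jointLaw (p n)) ω / n ≤ α := not_lt.1 hω
    rw [div_le_iff₀ hn'] at hω'
    show resDensity (ch.jointLaw (p n)) ω ≤ Real.logb 2 (M n) - n * (R' - α)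
    nlinarith
  linarith

/-! ### Normalized residual directed information -/

set_option linter.unusedSectionVars false in
theorem eventually_resInfo_lt (p : CodeFnLaw X Z) {a : ℝ} (ha : 0 < a) (h : ch.supRate p < a) :
    ∀ᶠ n : ℕ in atTop, resInfo (ch.jointLaw (p n)) / n < a := by
  obtain ⟨α, hα⟩ := iInf_lt_iff.1 h
  obtain ⟨hα, hαa⟩ := iInf_lt_iff.1 hα
  have hαa : α < a := by exact_mod_cast hαa
  -- The upper-tail bound needs a nonnegative level; `0 < a` leaves room to raise `α` to zero.
  have hmax : max α 0 < a := max_lt hαa ha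
  have hlim : Tendsto (fun n : ℕ => max α 0 + pr (ch.jointLaw (p n))
      {ω | resDensity (ch.jointLaw (p n)) ω / n > α} * Real.logb 2 (Fintype.card Y) +
      1 / Real.log 2 / n) atTop (𝓝 (max α 0)) := by
    simpa using ((hα.mul_const (Real.logb 2 (Fintype.card Y))).const_add (max α 0)).add
      (tendsto_const_div_atTop_nhds_zero_nat (1 / Real.log 2))
  filter_upwards [hlim.eventually_lt_const hmax, eventually_gt_atTop 0] with n hn hn0
  have hn' : (0 : ℝ) < n := by exact_mod_cast hn0
  refine lt_of_le_of_lt ?_ hn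
  have h1 := ch.resInfo_le (p n) (n * max α 0) (by positivity)
  have hK : 0 ≤ Real.logb 2 (Fintype.card Y) := by
    rw [Real.logb]
    exact div_nonneg (Real.log_natCast_nonneg _) (Real.log_nonneg one_le_two)
  have h2 : pr (ch.jointLaw (p n)) {ω | resDensity (ch.jointLaw (p n)) ω > n * max α 0} ≤
      pr (ch.jointLaw (p n)) {ω | resDensity (ch.jointLaw (p n)) ω / n > α} := by
    refine pr_mono _ fun ω hω => ?_
    have hω' : n * max α 0 < resDensity (ch.jointLaw (p n)) ω := hω
    show α < resDensity (ch.jointLaw (p n)) ω / n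
    rw [lt_div_iff₀ hn', mul_comm]
    exact lt_of_le_of_lt (mul_le_mul_of_nonneg_left (le_max_left α 0) hn'.le) hω'
  have h3 := mul_le_mul_of_nonneg_right h2 (mul_nonneg hn'.le hK)
  rw [div_le_iff₀ hn', add_mul, add_mul, div_mul_cancel₀ _ hn'.ne']
  linarith

set_option linter.unusedSectionVars false in
theorem eventually_lt_resInfo (p : CodeFnLaw X Z) {a : ℝ} (h : a < ch.infRate p) :
    ∀ᶠ n : ℕ in atTop, a < resInfo (ch.jointLaw (p n)) / n := by
  obtain ⟨β, hβ⟩ := lt_iSup_iff.1 h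
  obtain ⟨hβ, haβ⟩ := lt_iSup_iff.1 hβ
  have haβ : a < β := by exact_mod_cast haβ
  have hlim : Tendsto (fun n : ℕ => β * (1 - pr (ch.jointLaw (p n))
      {ω | resDensity (ch.jointLaw (p n)) ω / n < β}) - 1 / Real.log 2 / n) atTop (𝓝 β) := by
    simpa using ((hβ.const_sub 1).const_mul β).sub
      (tendsto_const_div_atTop_nhds_zero_nat (1 / Real.log 2))
  filter_upwards [hlim.eventually_const_lt haβ, eventually_gt_atTop 0] with n hn hn0
  have hn' : (0 : ℝ) < n := by exact_mod_cast hn0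
  refine hn.trans_le ?_
  have h1 := ch.le_resInfo (p n) (n * β)
  have h2 : {ω | resDensity (ch.jointLaw (p n)) ω < n * β} =
      {ω | resDensity (ch.jointLaw (p n)) ω / n < β} := by
    ext ω
    show resDensity (ch.jointLaw (p n)) ω < n * β ↔ resDensity (ch.jointLaw (p n)) ω / n < β
    rw [div_lt_iff₀ hn', mul_comm]
  rw [h2] at h1
  rw [le_div_iff₀ hn', sub_mul, div_mul_cancel₀ _ hn'.ne']
  linarith

theorem tendsto_resInfo (p : CodeFnLaw X Z) (h1 : ch.capacity ≤ ch.infRate p)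
    (h2 : ch.supRate p ≤ ch.capacity) :
    Tendsto (fun n : ℕ => ((resInfo (ch.jointLaw (p n)) / n : ℝ) : EReal)) atTop
      (𝓝 ch.capacity) := by
  refine tendsto_order.2 ⟨fun a ha => ?_, fun a ha => ?_⟩
  · obtain ⟨b, hab, hb⟩ := EReal.lt_iff_exists_real_btwn.1 ha
    filter_upwards [ch.eventually_lt_resInfo p (hb.trans_le h1)] with n hn
    exact hab.trans (by exact_mod_cast hn)
  · obtain ⟨b, hb, hab⟩ := EReal.lt_iff_exists_real_btwn.1 ha
    have hb0 : 0 < b := by exact_mod_cast ch.capacity_nonneg.trans_lt hb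
    filter_upwards [ch.eventually_resInfo_lt p hb0 (h2.trans_lt hb)] with n hn
    exact lt_trans (by exact_mod_cast hn) hab

theorem limit_resInfo_le_capacity (p : CodeFnLaw X Z) (h : ch.supRate p ≤ ch.capacity) (L : EReal)
    (hL : Tendsto (fun n : ℕ => ((resInfo (ch.jointLaw (p n)) / n : ℝ) : EReal)) atTop (𝓝 L)) :
    L ≤ ch.capacity := by
  refine EReal.le_of_forall_lt_iff_le.1 fun z hz => ?_
  have hz0 : 0 < z := by exact_mod_cast ch.capacity_nonneg.trans_lt hz
  refine le_of_tendsto hL ?_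
  filter_upwards [ch.eventually_resInfo_lt p hz0 (h.trans_lt hz)] with n hn
  exact_mod_cast hn.le

end Channel

end NoisyFeedback

end

/-! ### The equivalence and the capacity formula -/

theorem theorem5 {X Y Z : Type*} [Fintype X] [Nonempty X] [Fintype Y] [Fintype Z]
    (ch : NoisyFeedback.Channel X Y Z) :
    (ch.HasStrongConverse ↔
      (⨆ (q : NoisyFeedback.InputLaw X Z) (p : NoisyFeedback.CodeFnLaw X Z)
          (_ : NoisyFeedback.GoodFor p q), ch.infRate p) =
        ⨆ (q : NoisyFeedback.InputLaw X Z) (p : NoisyFeedback.CodeFnLaw X Z)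
          (_ : NoisyFeedback.GoodFor p q), ch.supRate p) ∧
    (ch.HasStrongConverse →
      ch.capacity =
        sSup {L : EReal | ∃ (q : NoisyFeedback.InputLaw X Z) (p : NoisyFeedback.CodeFnLaw X Z),
          NoisyFeedback.GoodFor p q ∧
          Tendsto (fun n : ℕ =>
            ((NoisyFeedback.resInfo (ch.jointLaw (p n)) / n : ℝ) : EReal)) atTop (𝓝 L)}) := by
  obtain ⟨p, hp⟩ := ch.exists_capacity_le_infRate
  obtain ⟨q, hq⟩ := NoisyFeedback.exists_goodFor p
  refine ⟨⟨fun h => le_antisymm ?_ ?_, fun h => ch.hasStrongConverse_of_supRate_le fun p' => ?_⟩,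
    fun h => le_antisymm (le_sSup ?_) (sSup_le ?_)⟩
  · exact iSup_mono fun q' => iSup_mono fun p' => iSup_mono fun _ => ch.infRate_le_supRate p'
  · refine (iSup_le fun q' => iSup_le fun p' => iSup_le fun _ =>
      ch.supRate_le_capacity h p').trans (hp.trans ?_)
    exact le_iSup_of_le q (le_iSup_of_le p (le_iSup_of_le hq le_rfl))
  · obtain ⟨q', hq'⟩ := NoisyFeedback.exists_goodFor p'
    calc ch.supRate p' ≤ ⨆ (q : NoisyFeedback.InputLaw X Z) (p : NoisyFeedback.CodeFnLaw X Z)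
          (_ : NoisyFeedback.GoodFor p q), ch.supRate p :=
        le_iSup_of_le q' (le_iSup_of_le p' (le_iSup_of_le hq' le_rfl))
      _ = _ := h.symm
      _ ≤ ch.capacity := iSup_le fun q => iSup_le fun p => iSup_le fun _ => ch.infRate_le_capacity p
  -- For the capacity-attaining law, inf-rate and sup-rate coincide with capacity, so the limit
  -- exists and is attained.
  · exact ⟨q, p, hq, ch.tendsto_resInfo p hp (ch.supRate_le_capacity h p)⟩
  · rintro L ⟨_, p', _, hL⟩
    exact ch.limit_resInfo_le_capacity p' (ch.supRate_le_capacity h p') L hL
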